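/- Let $N\ge 2$, $s\in(0,1)$, let $B$ be the open unit ball of $\mathbb{R}^N$, and let $L^1_s(\mathbb{R}^N)$ be the space of (real-valued, Lebesgue) measurable functions $u$ with $\int_{\mathbb{R}^N}\frac{|u(x)|}{1+|x|^{N+2s}}\,dx<\infty$, and $L^\infty_s(\mathbb{R}^N)$ the space of measurable functions $w$ for which $(1+|x|^{N+2s})|w(x)|$ is essentially bounded. For $\psi\in C_c^\infty(\mathbb{R}^N)$ put $$(-\Delta)^s\psi(x)=\frac{C_{N,s}}{2}\int_{\mathbb{R}^N}\frac{2\psi(x)-\psi(x+y)-\psi(x-y)}{|y|^{N+2s}}\,dy, \qquad C_{N,s}=\frac{s\,2^{2s}\,\Gamma(\frac N2+s)}{\pi^{N/2}\,\Gamma(1-s)},$$ and for $\varphi\in L^1_s(\mathbb{R}^N)$ let $(-\Delta)^s\varphi$ be defined in the sense of distributions, that is, $(-\Delta)^s\varphi=w$ means $\int_{\mathbb{R}^N}\varphi\,(-\Delta)^s\psi\,dx=\int_{\mathbb{R}^N}w\,\psi\,dx$ for all $\psi\in C_c^\infty(\mathbb{R}^N)$. Let $g\in L^1_s(\mathbb{R}^N)$,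 and let $u\in L^1_s(\mathbb{R}^N)$ be a very weak solution of $(-\Delta)^s u=0$ in $B$, $u=g$ in $B^c$; that is, $u=g$ a.e. in $B^c$ and $$\int_{\mathbb{R}^N}u\,(-\Delta)^s\varphi\,dx=0$$ for every $\varphi\in L^1_s(\mathbb{R}^N)$ compactly supported in $B$ with $(-\Delta)^s\varphi\in L^\infty_s(\mathbb{R}^N)$. If $u\in L^2_{\rm loc}(B)$, then $u\in H^{2s}_{\rm loc}(B)$, that is, $u\in H^{2s}(A)$ for every open set $A$ whose closure is a compact subset of $B$. Here, for $\sigma=k+\theta$ with $k\in\mathbb{N}_0$ and $\theta\in[0,1)$, the space $H^\sigma(A)$ consists of the $v\in L^2(A)$ whose weak derivatives $D^\alpha v$, $|\alpha|\le k$, exist and belong to $L^2(A)$ and, if $\theta>0$, satisfy $\int_A\int_A\frac{|D^\alpha v(x)-D^\alpha v(y)|^2}{|x-y|^{N+2\theta}}\,dy\,dx<\infty$ for all $|\alpha|\le k$. -/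

import Mathlib

open MeasureTheory Set Metric
open scoped ContDiff ENNReal

noncomputable section

namespace FracHarmonic

variable {N : ℕ}

/-- The weight `1 + |x|^(N+2s)`. -/
def weight (s : ℝ) (x : EuclideanSpace ℝ (Fin N)) : ℝ :=
  1 + ‖x‖ ^ ((N : ℝ) + 2 * s)

/-- The weighted Lebesgue space `L¹_s(ℝᴺ)`. -/
def MemL1s (s : ℝ) (u : EuclideanSpace ℝ (Fin N) → ℝ) : Prop :=
  AEStronglyMeasurable u volume ∧ Integrable (fun x => u x / weight s x) volume

/-- The weighted space `L^∞_s(ℝᴺ)`: `(1 + |x|^(N+2s)) |w(x)|` is essentially bounded. -/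
def MemLinfs (s : ℝ) (w : EuclideanSpace ℝ (Fin N) → ℝ) : Prop :=
  AEStronglyMeasurable w volume ∧ ∃ C : ℝ, ∀ᵐ x ∂volume, weight s x * |w x| ≤ C

/-- The space `L²_loc(Ω)`. -/
def MemL2loc (Ω : Set (EuclideanSpace ℝ (Fin N))) (u : EuclideanSpace ℝ (Fin N) → ℝ) : Prop :=
  ∀ K : Set (EuclideanSpace ℝ (Fin N)), IsCompact K → K ⊆ Ω → MemLp u 2 (volume.restrict K)

/-- `φ ∈ C_c^∞(Ω)`. -/
def IsSmoothTest (Ω : Set (EuclideanSpace ℝ (Fin N))) (φ : EuclideanSpace ℝ (Fin N) → ℝ) : Prop :=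
  ContDiff ℝ ∞ φ ∧ HasCompactSupport φ ∧ tsupport φ ⊆ Ω

/-- The normalising constant `C_{N,s} = s 2^(2s) Γ(N/2+s) / (π^(N/2) Γ(1-s))`. -/
def fracConst (N : ℕ) (s : ℝ) : ℝ :=
  s * 2 ^ (2 * s) * Real.Gamma ((N : ℝ) / 2 + s) /
    (Real.pi ^ ((N : ℝ) / 2) * Real.Gamma (1 - s))

/-- The pointwise fractional Laplacian, in its second-difference form; for `ψ ∈ C_c^∞(ℝᴺ)` and
`0 < s < 1` the integral converges absolutely at every point. -/
def fracLap (s : ℝ) (ψ : EuclideanSpace ℝ (Fin N) → ℝ) (x : EuclideanSpace ℝ (Fin N)) : ℝ :=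
  fracConst N s / 2 *
    ∫ y, (2 * ψ x - ψ (x + y) - ψ (x - y)) / ‖y‖ ^ ((N : ℝ) + 2 * s)

/-- `w = (-Δ)^s φ` in the sense of distributions on `ℝᴺ`; meant for `φ ∈ L¹_s(ℝᴺ)` and `w` locally
integrable, in which case both integrals converge absolutely. -/
def IsFracLap (s : ℝ) (φ w : EuclideanSpace ℝ (Fin N) → ℝ) : Prop :=
  ∀ ψ : EuclideanSpace ℝ (Fin N) → ℝ, IsSmoothTest univ ψ →
    ∫ x, φ x * fracLap s ψ x = ∫ x, w x * ψ x

/-- `u` is a very weak solution of `(-Δ)^s w = 0` in `Ω`, `w = g` in `Ωᶜ`: `u ∈ L¹_s(ℝᴺ)`,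
`∫ u (-Δ)^s φ = 0` for every `φ` compactly supported in `Ω` with `(-Δ)^s φ ∈ L^∞_s(ℝᴺ)`, and
`u = g` a.e. in `Ωᶜ`. -/
structure IsVeryWeakSolution (s : ℝ) (Ω : Set (EuclideanSpace ℝ (Fin N)))
    (g u : EuclideanSpace ℝ (Fin N) → ℝ) : Prop where
  memL1s : MemL1s s u
  integral_eq_zero : ∀ φ w : EuclideanSpace ℝ (Fin N) → ℝ,
    MemL1s s φ → HasCompactSupport φ → tsupport φ ⊆ Ω →
    IsFracLap s φ w → MemLinfs s w → ∫ x, u x * w x = 0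
  exterior : ∀ᵐ x ∂volume, x ∉ Ω → u x = g x

/-- `v` is the weak derivative `∂_{ι 0} ⋯ ∂_{ι (m-1)} u` in the open set `Ω`. -/
def IsWeakDeriv (Ω : Set (EuclideanSpace ℝ (Fin N))) {m : ℕ} (ι : Fin m → Fin N)
    (u v : EuclideanSpace ℝ (Fin N) → ℝ) : Prop :=
  LocallyIntegrableOn u Ω volume ∧ LocallyIntegrableOn v Ω volume ∧
  ∀ φ : EuclideanSpace ℝ (Fin N) → ℝ, IsSmoothTest Ω φ →
    ∫ x in Ω, u x * iteratedFDeriv ℝ m φ x (fun i => EuclideanSpace.single (ι i) (1 : ℝ))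
      = (-1) ^ m * ∫ x in Ω, v x * φ x

/-- The squared Gagliardo seminorm `[u]²_{H^θ(Ω)}`, with values in `[0,∞]`. -/
def gagliardoSq (θ : ℝ) (Ω : Set (EuclideanSpace ℝ (Fin N)))
    (u : EuclideanSpace ℝ (Fin N) → ℝ) : ℝ≥0∞ :=
  ∫⁻ x in Ω, ∫⁻ y in Ω,
    ENNReal.ofReal (|u x - u y| ^ 2 / ‖x - y‖ ^ ((N : ℝ) + 2 * θ))

/-- The Sobolev space `H^σ(Ω)`, `σ ≥ 0`, `σ = k + θ` with `k = ⌊σ⌋` and `θ ∈ [0,1)`: all weak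
derivatives of order at most `k` (including `u` itself) exist in `L²(Ω)` and, if `θ > 0`, have
finite Gagliardo seminorm of order `θ`. -/
def MemH (σ : ℝ) (Ω : Set (EuclideanSpace ℝ (Fin N)))
    (u : EuclideanSpace ℝ (Fin N) → ℝ) : Prop :=
  MemLp u 2 (volume.restrict Ω) ∧
  ∀ m : ℕ, m ≤ ⌊σ⌋₊ → ∀ ι : Fin m → Fin N, ∃ v : EuclideanSpace ℝ (Fin N) → ℝ,
    IsWeakDeriv Ω ι u v ∧ MemLp v 2 (volume.restrict Ω) ∧
    (0 < Int.fract σ → gagliardoSq (Int.fract σ) Ω v < ⊤)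

/-- The space `H^σ_loc(Ω)`: `u ∈ H^σ(A)` for every open `A` whose closure is a compact subset
of `Ω`. -/
def MemHloc (σ : ℝ) (Ω : Set (EuclideanSpace ℝ (Fin N)))
    (u : EuclideanSpace ℝ (Fin N) → ℝ) : Prop :=
  ∀ A : Set (EuclideanSpace ℝ (Fin N)), IsOpen A → IsCompact (closure A) → closure A ⊆ Ω →
    MemH σ A u

end FracHarmonic

end

set_option linter.unusedSectionVars false

noncomputable section

namespace FracHarmonic

open Module Filter Topology

/-! Write `N` for the dimension, `a = N + 2s`, so `N < a < N + 2`, and `L` for the hypersingular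
integral with kernel `|y|^(-a)`, a positive multiple of the fractional Laplacian. The solution is
shown to coincide a.e., near each compact part of the ball, with its convolution against one fixed
`C²` kernel. This is a nonlocal mean value property.

Let `b` be a smooth radially decreasing bump. Since `L (b(ρ·)) = ρ^(2s) (L b)(ρ·)`, the potential
`∫_{T₀}^T ρ^(N-1-2s) b(ρx) dρ`, a smoothed truncation of the Riesz kernel `|x|^(2s-N)`, is supported
in the ball of radius `1/T₀` and is mapped by `L` to `∫_{T₀}^T ρ^(N-1) (L b)(ρx) dρ = K_T - K_{T₀}`.
Here `K_T(x) = T^N K(Tx)` and `K(x) = ∫_0^1 ρ^(N-1) (L b)(ρx) dρ`. Translates of the potential are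
admissible test functions, so `u * K_T = u * K_{T₀}` at points farther than `1/T₀` from the sphere.
As `T → ∞` the left side tends weakly to `(∫ K) u` (`tendsto_integral_mul_scaledKer`), whence `u =
(∫ K)⁻¹ u * K_{T₀}` a.e. (`ae_eq_integral_smul_scaledKer`).

Two facts about `K` carry this. First, `K` and its first two derivatives are `O((1+|x|)^(-a))`,
exactly the decay that pairs with `L¹_s` (`exists_resKer_le`, `exists_fderiv_resKer`); for `K`
itself it rests on the cancellation `∫ L b = 0`. Second, `∫ K > 0`, because `K(x)` is a positive
multiple of the mean of `L b` over the ball of radius `|x|`, which is nonnegative for radially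
decreasing `b`. The convolution then has locally bounded second derivatives, which gives every
Sobolev order below two, in particular `2s`. -/

variable {E : Type*} [NormedAddCommGroup E] [InnerProductSpace ℝ E] [FiniteDimensional ℝ E]
  [MeasurableSpace E] [BorelSpace E]
variable {G : Type*} [NormedAddCommGroup G] [NormedSpace ℝ G]

/-! ### Second differences and the hypersingular integral -/

/-- The symmetric second difference of `f` at `x` with step `y`. -/
def secondDiff (f : E → G) (x y : E) : G := (2 : ℝ) • f x - f (x + y) - f (x - y)

/-- The hypersingular integral of order `a - finrank ℝ E`. -/
def hyperInt (a : ℝ) (f : E → G) (x : E) : G := ∫ y, (‖y‖ ^ a)⁻¹ • secondDiff f x y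

/-- The integrable function that dominates the hypersingular integrand of a smooth function. -/
def kerMin (a : ℝ) (y : E) : ℝ := min 1 (‖y‖ ^ 2) * (‖y‖ ^ a)⁻¹

lemma kerMin_nonneg (a : ℝ) (y : E) : 0 ≤ kerMin a y := by
  unfold kerMin; positivity

/-- In polar coordinates the radial exponent is `N + 1 - a > -1` near the origin and `N - 1 - a <
-1` at infinity; these are the two bounds on `a`. -/
lemma integrable_kerMin [Nontrivial E] {a : ℝ} (h1 : (finrank ℝ E : ℝ) < a)
    (h2 : a < finrank ℝ E + 2) : Integrable (kerMin a : E → ℝ) := by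
  have hd : 0 < finrank ℝ E := finrank_pos
  have hd' : ((finrank ℝ E - 1 : ℕ) : ℝ) = (finrank ℝ E : ℝ) - 1 := by
    rw [Nat.cast_sub hd]; simp
  refine (integrable_fun_norm_addHaar (E := E) volume
    (f := fun r => min 1 (r ^ 2) * (r ^ a)⁻¹)).2 ?_
  rw [← Ioc_union_Ioi_eq_Ioi (zero_le_one' ℝ)]
  refine IntegrableOn.union ?_ ?_
  · have : IntegrableOn (fun r : ℝ => r ^ ((finrank ℝ E : ℝ) + 1 - a)) (Ioc 0 1) := by
      rw [← intervalIntegrable_iff_integrableOn_Ioc_of_le zero_le_one]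
      exact intervalIntegral.intervalIntegrable_rpow' (by linarith)
    refine this.congr_fun ?_ measurableSet_Ioc
    intro r hr
    have h : r ^ 2 ≤ 1 := pow_le_one₀ hr.1.le hr.2
    simp only [smul_eq_mul, min_eq_right h]
    rw [← Real.rpow_natCast r (finrank ℝ E - 1), ← Real.rpow_natCast r 2, ← Real.rpow_neg hr.1.le,
      ← Real.rpow_add hr.1, ← Real.rpow_add hr.1, hd']
    congr 1; push_cast; ring
  · have : IntegrableOn (fun r : ℝ => r ^ ((finrank ℝ E : ℝ) - 1 - a)) (Ioi 1) :=
      integrableOn_Ioi_rpow_of_lt (by linarith) one_pos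
    refine this.congr_fun ?_ measurableSet_Ioi
    intro r hr
    have hr0 : 0 < r := one_pos.trans hr
    have h : 1 ≤ r ^ 2 := one_le_pow₀ (le_of_lt hr)
    simp only [smul_eq_mul, min_eq_left h, one_mul]
    rw [← Real.rpow_natCast r (finrank ℝ E - 1), ← Real.rpow_neg hr0.le,
      ← Real.rpow_add hr0, hd']
    congr 1

/-- The quadratic bound applies the mean value inequality twice: `z ↦ f (x + z) + f (x - z)` has
derivative `Df(x+z) - Df(x-z)`, which is at most `2M|z|`. -/
lemma norm_secondDiff_le_of_bounds {f : E → G} {M : ℝ} (hf : ContDiff ℝ 2 f)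
    (h0 : ∀ x, ‖f x‖ ≤ M) (h2 : ∀ x, ‖fderiv ℝ (fderiv ℝ f) x‖ ≤ M) (x y : E) :
    ‖secondDiff f x y‖ ≤ 4 * M * min 1 (‖y‖ ^ 2) := by
  have hM : 0 ≤ M := (norm_nonneg _).trans (h0 0)
  have hd : Differentiable ℝ f := hf.differentiable two_ne_zero
  have hd1 : Differentiable ℝ (fderiv ℝ f) :=
    (hf.fderiv_right (m := 1) (by norm_num)).differentiable one_ne_zero
  rw [mul_min_of_nonneg _ _ (by positivity), mul_one]
  refine le_min ?_ ?_
  · unfold secondDiff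
    calc _ ≤ ‖(2 : ℝ) • f x‖ + ‖f (x + y)‖ + ‖f (x - y)‖ :=
          (norm_sub_le _ _).trans (add_le_add_left (norm_sub_le _ _) _)
      _ ≤ 2 * M + M + M := by
          rw [norm_smul, Real.norm_ofNat]
          gcongr <;> apply h0
      _ = 4 * M := by ring
  · have key := (convex_closedBall (0 : E) ‖y‖).norm_image_sub_le_of_norm_hasFDerivWithin_le
      (𝕜 := ℝ) (f := fun z => f (x + z) + f (x - z))
      (f' := fun z => fderiv ℝ f (x + z) - fderiv ℝ f (x - z)) (C := 2 * M * ‖y‖) (x := 0) (y := y)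
      (fun z _ => by
        have e1 : HasFDerivAt (fun z => f (x + z)) (fderiv ℝ f (x + z)) z :=
          (hasFDerivAt_comp_add_left x).2 (hd _).hasFDerivAt
        have e2 : HasFDerivAt (fun z => f (x - z)) (-fderiv ℝ f (x - z)) z := by
          have := (hd (x - z)).hasFDerivAt.comp z ((hasFDerivAt_id z).const_sub x)
          rwa [ContinuousLinearMap.comp_neg, ContinuousLinearMap.comp_id] at this
        rw [sub_eq_add_neg]
        exact (e1.add e2).hasFDerivWithinAt)
      (fun z hz => by
        have := convex_univ.norm_image_sub_le_of_norm_fderiv_le (𝕜 := ℝ) (f := fderiv ℝ f)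
          (fun x _ => hd1 x) (fun x _ => h2 x) (mem_univ (x - z)) (mem_univ (x + z))
        have hz' : ‖z‖ ≤ ‖y‖ := by simpa using hz
        calc _ ≤ M * ‖x + z - (x - z)‖ := this
          _ = M * ‖(2 : ℝ) • z‖ := by congr 2; rw [two_smul]; abel
          _ = 2 * M * ‖z‖ := by rw [norm_smul, Real.norm_ofNat]; ring
          _ ≤ _ := by gcongr)
      (by simp) (by simp)
    calc ‖secondDiff f x y‖ = ‖(f (x + y) + f (x - y)) - (f (x + 0) + f (x - 0))‖ := by
          rw [← norm_neg]; congr 1; simp only [secondDiff, two_smul, add_zero, sub_zero]; abel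
      _ ≤ 2 * M * ‖y‖ * ‖y - 0‖ := key
      _ ≤ 4 * M * ‖y‖ ^ 2 := by rw [sub_zero]; nlinarith [mul_nonneg hM (sq_nonneg ‖y‖)]

lemma contDiff_infty_fderiv {f : E → G} (hf : ContDiff ℝ ∞ f) : ContDiff ℝ ∞ (fderiv ℝ f) :=
  hf.fderiv_right (m := ∞) (by simp)

lemma exists_norm_secondDiff_le {f : E → G} (hf : ContDiff ℝ ∞ f) (hc : HasCompactSupport f) :
    ∃ M, 0 ≤ M ∧ ∀ x y, ‖secondDiff f x y‖ ≤ M * min 1 (‖y‖ ^ 2) := by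
  obtain ⟨M0, hM0⟩ := hf.continuous.bounded_above_of_compact_support hc
  obtain ⟨M2, hM2⟩ := (contDiff_infty_fderiv (contDiff_infty_fderiv
    hf)).continuous.bounded_above_of_compact_support ((hc.fderiv (𝕜 := ℝ)).fderiv (𝕜 := ℝ))
  have h2 : ContDiff ℝ 2 f := contDiff_infty.1 hf 2
  have := norm_secondDiff_le_of_bounds (M := max M0 M2) h2
    (fun x => (hM0 x).trans (le_max_left _ _)) (fun x => (hM2 x).trans (le_max_right _ _))
  exact ⟨4 * max M0 M2, mul_nonneg (by norm_num) (((norm_nonneg _).trans (hM0 0)).trans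
    (le_max_left _ _)), this⟩

lemma norm_kernel_smul_secondDiff_le {f : E → G} {M a : ℝ}
    (hM : ∀ x y, ‖secondDiff f x y‖ ≤ M * min 1 (‖y‖ ^ 2)) (x y : E) :
    ‖(‖y‖ ^ a)⁻¹ • secondDiff f x y‖ ≤ M * kerMin a y := by
  have hp : 0 ≤ (‖y‖ ^ a)⁻¹ := by positivity
  rw [norm_smul, Real.norm_of_nonneg hp, kerMin, mul_comm, ← mul_assoc]
  exact mul_le_mul_of_nonneg_right (hM x y) hp

lemma measurable_kernel (a : ℝ) : Measurable fun y : E => (‖y‖ ^ a)⁻¹ := by fun_prop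

lemma continuous_secondDiff {f : E → G} (hf : Continuous f) :
    Continuous fun p : E × E => secondDiff f p.1 p.2 := by
  unfold secondDiff; fun_prop

section

variable [Nontrivial E] {a : ℝ} (h1 : (finrank ℝ E : ℝ) < a) (h2 : a < finrank ℝ E + 2)

include h1 h2

lemma integrable_hyperInt {f : E → G} {M : ℝ} (hf : Continuous f)
    (hM : ∀ x y, ‖secondDiff f x y‖ ≤ M * min 1 (‖y‖ ^ 2)) (x : E) :
    Integrable fun y => (‖y‖ ^ a)⁻¹ • secondDiff f x y := by
  refine ((integrable_kerMin h1 h2).const_mul M).mono' ?_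
    (.of_forall fun y => norm_kernel_smul_secondDiff_le hM x y)
  exact (measurable_kernel a).aestronglyMeasurable.smul
    ((continuous_secondDiff hf).comp (Continuous.prodMk_right x)).aestronglyMeasurable

lemma norm_hyperInt_le {f : E → G} {M : ℝ}
    (hM : ∀ x y, ‖secondDiff f x y‖ ≤ M * min 1 (‖y‖ ^ 2)) (x : E) :
    ‖hyperInt a f x‖ ≤ M * ∫ y : E, kerMin a y := by
  rw [← integral_const_mul]
  exact norm_integral_le_of_norm_le ((integrable_kerMin h1 h2).const_mul M)
    (.of_forall fun y => norm_kernel_smul_secondDiff_le hM x y)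

/-- Differentiation under the integral, with `kerMin` as majorant. Vector-valued `f` makes the
derivative again a hypersingular integral, so the lemma can be iterated. -/
lemma hasFDerivAt_hyperInt {f : E → G} (hf : ContDiff ℝ ∞ f) (hc : HasCompactSupport f) (x : E) :
    HasFDerivAt (hyperInt a f) (hyperInt a (fderiv ℝ f) x) x := by
  have hf1 : ContDiff ℝ ∞ (fderiv ℝ f) := contDiff_infty_fderiv hf
  have hd : Differentiable ℝ f := hf.differentiable (by simp)
  obtain ⟨M, -, hM⟩ := exists_norm_secondDiff_le hf hc
  obtain ⟨M', -, hM'⟩ := exists_norm_secondDiff_le hf1 (hc.fderiv (𝕜 := ℝ))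
  refine hasFDerivAt_integral_of_dominated_of_fderiv_le (s := univ) univ_mem
    (.of_forall fun x => (integrable_hyperInt h1 h2 hf.continuous hM x).aestronglyMeasurable)
    (integrable_hyperInt h1 h2 hf.continuous hM x)
    (integrable_hyperInt h1 h2 hf1.continuous hM' x).aestronglyMeasurable
    (.of_forall fun y x _ => norm_kernel_smul_secondDiff_le hM' x y)
    ((integrable_kerMin h1 h2).const_mul M') (.of_forall fun y x _ => ?_)
  refine HasFDerivAt.const_smul ?_ _
  have e1 : HasFDerivAt (fun x => f (x + y)) (fderiv ℝ f (x + y)) x :=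
    (hasFDerivAt_comp_add_right y).2 (hd _).hasFDerivAt
  have e2 : HasFDerivAt (fun x => f (x - y)) (fderiv ℝ f (x - y)) x :=
    (hasFDerivAt_comp_sub y).2 (hd _).hasFDerivAt
  exact (((hd x).hasFDerivAt.const_smul (2 : ℝ)).sub e1).sub e2

lemma continuous_hyperInt {f : E → G} (hf : ContDiff ℝ ∞ f) (hc : HasCompactSupport f) :
    Continuous (hyperInt a f) :=
  continuous_iff_continuousAt.2 fun x => (hasFDerivAt_hyperInt h1 h2 hf hc x).continuousAt

/-- For `|x| ≥ 2` the value `f x` vanishes and only steps with `|y| ≥ |x|/2` reach the support.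
There the kernel is at most `(|x|/2)^(-a)`, and what remains is the `L¹` norm of `f`. -/
lemma exists_norm_hyperInt_le {f : E → G} (hf : ContDiff ℝ ∞ f) (hc : HasCompactSupport f)
    (hsupp : ∀ x, 1 ≤ ‖x‖ → f x = 0) :
    ∃ C, 0 ≤ C ∧ ∀ x, ‖hyperInt a f x‖ ≤ C * (1 + ‖x‖) ^ (-a) := by
  have ha : 0 < a := lt_of_le_of_lt (by positivity) h1
  obtain ⟨M, hM0, hM⟩ := exists_norm_secondDiff_le hf hc
  set I := ∫ y : E, kerMin a y
  have hI : 0 ≤ I := integral_nonneg (kerMin_nonneg a)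
  have hfi : Integrable f := hf.continuous.integrable_of_hasCompactSupport hc
  set F := ∫ y, ‖f y‖
  have hF : 0 ≤ F := integral_nonneg fun _ => norm_nonneg _
  refine ⟨3 ^ a * (M * I) + 4 ^ a * (2 * F), by positivity, fun x => ?_⟩
  have hx0 : 0 < 1 + ‖x‖ := by positivity
  rw [Real.rpow_neg hx0.le, ← div_eq_mul_inv, le_div_iff₀ (by positivity)]
  rcases le_total ‖x‖ 2 with hx | hx
  · calc ‖hyperInt a f x‖ * (1 + ‖x‖) ^ a ≤ (M * I) * 3 ^ a := by
          gcongr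
          · exact norm_hyperInt_le h1 h2 hM x
          · linarith
      _ ≤ _ := by rw [mul_comm]; exact le_add_of_nonneg_right (by positivity)
  · have hb : ‖hyperInt a f x‖ ≤ ∫ y, ((‖x‖ / 2) ^ a)⁻¹ * (‖f (x + y)‖ + ‖f (x - y)‖) := by
      refine norm_integral_le_of_norm_le ?_ (.of_forall fun y => ?_)
      · exact ((hfi.comp_add_left x).norm.add (hfi.comp_sub_left x).norm).const_mul _
      · have hfx : f x = 0 := hsupp x (by linarith)
        rw [norm_smul, Real.norm_of_nonneg (by positivity), secondDiff, hfx, smul_zero, zero_sub]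
        rcases le_total (‖x‖ / 2) ‖y‖ with hy | hy
        · have hxp : 0 < (‖x‖ / 2) ^ a := Real.rpow_pos_of_pos (by linarith) _
          gcongr
          exact (norm_sub_le _ _).trans (by rw [norm_neg])
        · have q1 : f (x + y) = 0 := hsupp _ (by
            have := norm_sub_le (x + y) y
            rw [add_sub_cancel_right] at this; linarith)
          have q2 : f (x - y) = 0 := hsupp _ (by
            have := norm_add_le (x - y) y
            rw [sub_add_cancel] at this; linarith)
          rw [q1, q2]; simp
    have hint : ∫ y, ((‖x‖ / 2) ^ a)⁻¹ * (‖f (x + y)‖ + ‖f (x - y)‖)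
        = ((‖x‖ / 2) ^ a)⁻¹ * (2 * F) := by
      rw [integral_const_mul, integral_add (hfi.comp_add_left x).norm (hfi.comp_sub_left x).norm,
        integral_add_left_eq_self (fun y => ‖f y‖) x,
        integral_sub_left_eq_self (fun y => ‖f y‖) volume x]
      ring
    rw [hint] at hb
    have hxp : 0 < (‖x‖ / 2) ^ a := Real.rpow_pos_of_pos (by linarith) _
    calc ‖hyperInt a f x‖ * (1 + ‖x‖) ^ a
        ≤ (((‖x‖ / 2) ^ a)⁻¹ * (2 * F)) * (4 * (‖x‖ / 2)) ^ a := by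
          gcongr
          linarith
      _ = 4 ^ a * (2 * F) := by
          rw [Real.mul_rpow (by norm_num) (by linarith)]
          field_simp
      _ ≤ _ := le_add_of_nonneg_left (by positivity)

/-- The hypersingular integral is symmetric. -/
lemma integral_mul_hyperInt {f g : E → ℝ} (hf : ContDiff ℝ ∞ f) (hfc : HasCompactSupport f)
    (hg : ContDiff ℝ ∞ g) (hgc : HasCompactSupport g) :
    ∫ x, f x * hyperInt a g x = ∫ x, hyperInt a f x * g x := by
  have hint : ∀ {f g : E → ℝ}, ContDiff ℝ ∞ f → HasCompactSupport f → ContDiff ℝ ∞ g →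
      HasCompactSupport g →
      Integrable (fun p : E × E => f p.1 * ((‖p.2‖ ^ a)⁻¹ • secondDiff g p.1 p.2))
        (volume.prod volume) := by
    intro f g hf hfc hg hgc
    obtain ⟨M, hM0, hM⟩ := exists_norm_secondDiff_le hg hgc
    have hfi : Integrable f := hf.continuous.integrable_of_hasCompactSupport hfc
    refine (hfi.norm.mul_prod ((integrable_kerMin h1 h2).const_mul M)).mono' ?_
      (.of_forall fun p => ?_)
    · have hk : AEStronglyMeasurable (fun p : E × E => (‖p.2‖ ^ a)⁻¹) (volume.prod volume) :=
        ((measurable_kernel a).comp measurable_snd).aestronglyMeasurable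
      exact (hf.continuous.comp continuous_fst).aestronglyMeasurable.mul
        (hk.smul (continuous_secondDiff hg.continuous).aestronglyMeasurable)
    · rw [norm_mul]
      exact mul_le_mul_of_nonneg_left (norm_kernel_smul_secondDiff_le hM p.1 p.2) (norm_nonneg _)
  -- Fubini moves the step `y` outside, so symmetry need only be checked for each fixed `y`.
  have hL : ∀ {f g : E → ℝ}, ContDiff ℝ ∞ f → HasCompactSupport f → ContDiff ℝ ∞ g →
      HasCompactSupport g →
      ∫ x, f x * hyperInt a g x = ∫ y : E, (‖y‖ ^ a)⁻¹ * ∫ x, f x * secondDiff g x y := by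
    intro f g hf hfc hg hgc
    simp only [hyperInt, ← integral_const_mul]
    rw [integral_integral_swap (hint hf hfc hg hgc)]
    congr! 4 with y x
    simp only [smul_eq_mul]; ring
  simp only [mul_comm _ (g _)]
  rw [hL hf hfc hg hgc, hL hg hgc hf hfc]
  congr! 3 with y
  have hI : ∀ z : E, Integrable fun x => f x * g (x + z) := fun z =>
    (hf.continuous.mul (hg.continuous.comp (continuous_add_const z))).integrable_of_hasCompactSupport
      hfc.mul_right
  have hI' : ∀ z : E, Integrable fun x => g x * f (x + z) := fun z =>
    (hg.continuous.mul (hf.continuous.comp (continuous_add_const z))).integrable_of_hasCompactSupport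
      hgc.mul_right
  -- Translation moves the shift to the other factor with opposite sign; the second difference is
  -- even in `y`, so the two shifted terms just trade places.
  have hsw : ∀ z : E, ∫ x, f x * g (x + z) = ∫ x, g x * f (x + -z) := by
    intro z
    rw [← integral_add_right_eq_self (fun x => f x * g (x + z)) (-z)]
    congr! 2 with x
    rw [neg_add_cancel_right, mul_comm]
  have e : ∀ {f g : E → ℝ}, (∀ z : E, Integrable fun x => f x * g (x + z)) →
      ∫ x, f x * secondDiff g x y
        = 2 * (∫ x, f x * g (x + 0)) - (∫ x, f x * g (x + y)) - ∫ x, f x * g (x + -y) := by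
    intro f g h
    rw [← integral_const_mul, ← integral_sub ((h 0).const_mul 2) (h y)]
    refine Eq.trans ?_ (integral_sub (((h 0).const_mul 2).sub (h y)) (h (-y)))
    congr! 2 with x
    simp only [secondDiff, smul_eq_mul, add_zero, sub_eq_add_neg]; ring
  rw [e hI, e hI', hsw 0, hsw y, hsw (-y), neg_neg, neg_zero]
  ring

end

/-! ### Covariance of the hypersingular integral, and weight inequalities -/

lemma hyperInt_comp_smul (a : ℝ) (f : E → G) {r : ℝ} (hr : 0 < r) (x : E) :
    hyperInt a (fun z => f (r • z)) x = r ^ (a - finrank ℝ E) • hyperInt a f (r • x) := by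
  have := Measure.integral_comp_smul (volume : Measure E)
    (fun y => (‖y‖ ^ a)⁻¹ • secondDiff f (r • x) y) r
  rw [hyperInt, hyperInt, Real.rpow_sub hr, div_eq_mul_inv, mul_smul, Real.rpow_natCast,
    ← abs_of_pos (inv_pos.2 (pow_pos hr (finrank ℝ E))), ← this, ← integral_smul]
  congr! 2 with y
  rw [smul_smul, norm_smul, Real.norm_of_nonneg hr.le, Real.mul_rpow hr.le (norm_nonneg _),
    mul_inv, ← mul_assoc, mul_inv_cancel₀ (Real.rpow_pos_of_pos hr a).ne', one_mul]
  simp [secondDiff, smul_add, smul_sub]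

lemma hyperInt_comp_sub_left (a : ℝ) (f : E → G) (x z : E) :
    hyperInt a (fun y => f (x - y)) z = hyperInt a f (x - z) := by
  unfold hyperInt secondDiff
  congr! 3 with y
  simp only [show x - (z - y) = x - z + y by abel, show x - (z + y) = x - z - y by abel]
  abel

lemma hyperInt_comp_isometry (a : ℝ) (f : E → G) (U : E ≃ₗᵢ[ℝ] E) (hU : ∀ x, f (U x) = f x)
    (x : E) : hyperInt a f (U x) = hyperInt a f x := by
  have := U.measurePreserving.integral_comp U.toHomeomorph.measurableEmbedding
    (fun y => (‖y‖ ^ a)⁻¹ • secondDiff f (U x) y)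
  rw [hyperInt, ← this, hyperInt]
  congr! 2 with y
  simp only [secondDiff, ← map_add, ← map_sub, hU, U.norm_map]

/-- Peetre's inequality. It lets a kernel decaying like the weight be translated at a cost depending
only on `x`. -/
lemma one_add_norm_sub_rpow_neg_le {a : ℝ} (ha : 0 ≤ a) (x y : E) :
    (1 + ‖x - y‖) ^ (-a) ≤ (1 + ‖x‖) ^ a * (1 + ‖y‖) ^ (-a) := by
  have hx : 0 < 1 + ‖x‖ := by positivity
  have hy : 0 < 1 + ‖y‖ := by positivity
  have hxy : 0 < 1 + ‖x - y‖ := by positivity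
  have h : 1 + ‖y‖ ≤ (1 + ‖x‖) * (1 + ‖x - y‖) := by
    have := norm_sub_norm_le y x
    rw [norm_sub_rev y x] at this
    nlinarith [mul_nonneg (norm_nonneg x) (norm_nonneg (x - y))]
  rw [Real.rpow_neg hxy.le, Real.rpow_neg hy.le, ← div_eq_mul_inv,
    le_div_iff₀ (Real.rpow_pos_of_pos hy a), inv_mul_le_iff₀ (Real.rpow_pos_of_pos hxy a), mul_comm,
    ← Real.mul_rpow hx.le hxy.le]
  exact Real.rpow_le_rpow hy.le h ha

lemma one_add_norm_smul_rpow_neg_le {a ρ : ℝ} (ha : 0 ≤ a) (hρ : 0 < ρ) (hρ1 : ρ ≤ 1) (x : E) :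
    (1 + ‖ρ • x‖) ^ (-a) ≤ ρ ^ (-a) * (1 + ‖x‖) ^ (-a) := by
  have hx : 0 < 1 + ‖x‖ := by positivity
  rw [← Real.mul_rpow hρ.le hx.le, norm_smul, Real.norm_of_nonneg hρ.le]
  exact Real.rpow_le_rpow_of_nonpos (by positivity) (by nlinarith) (by linarith)

/-! ### The bump function and its hypersingular integral -/

/-- A smooth, radially decreasing bump function supported in the unit ball. -/
def radialBump (x : E) : ℝ := expNegInvGlue (1 - ‖x‖ ^ 2)

lemma contDiff_radialBump : ContDiff ℝ ∞ (radialBump : E → ℝ) :=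
  (expNegInvGlue.contDiff (n := ⊤)).comp (contDiff_const.sub (contDiff_norm_sq ℝ))

lemma radialBump_eq_zero {x : E} (hx : 1 ≤ ‖x‖) : radialBump x = 0 :=
  expNegInvGlue.zero_of_nonpos (by nlinarith)

lemma hasCompactSupport_radialBump : HasCompactSupport (radialBump : E → ℝ) :=
  HasCompactSupport.intro (isCompact_closedBall 0 1) fun x hx => radialBump_eq_zero (by
    rw [mem_closedBall_zero_iff, not_le] at hx; exact hx.le)

lemma radialBump_nonneg (x : E) : 0 ≤ radialBump x := expNegInvGlue.nonneg _

lemma radialBump_anti {x y : E} (h : ‖x‖ ≤ ‖y‖) : radialBump y ≤ radialBump x :=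
  expNegInvGlue.monotone (by nlinarith [norm_nonneg x])

lemma radialBump_zero_pos : 0 < radialBump (0 : E) := expNegInvGlue.pos_of_pos (by simp)

/-- The fractional Laplacian of the bump function, up to a constant. -/
def bumpLap (a : ℝ) : E → ℝ := hyperInt a radialBump

/-- The reflection exchanging `x` and `y` preserves the bump and commutes with the operator.
Radiality turns integrals along rays into integrals over space. -/
lemma bumpLap_eq_of_norm_eq (a : ℝ) {x y : E} (h : ‖x‖ = ‖y‖) : bumpLap a x = bumpLap a y := by
  set U : E ≃ₗᵢ[ℝ] E := (Submodule.span ℝ {x - y})ᗮ.reflection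
  have hU : U x = y := Submodule.reflection_sub h
  rw [← hU]
  exact (hyperInt_comp_isometry a radialBump U (fun z => by simp [radialBump]) x).symm

lemma bumpLap_dilation (a : ℝ) {r : ℝ} (hr : 0 < r) (x : E) :
    hyperInt a (fun z : E => radialBump (r • z)) x = r ^ (a - finrank ℝ E) * bumpLap a (r • x) :=
  hyperInt_comp_smul a radialBump hr x

lemma hasCompactSupport_comp_smul {f : E → G} (hf : HasCompactSupport f) {r : ℝ} (hr : 0 < r) :
    HasCompactSupport fun x => f (r • x) :=
  hf.comp_homeomorph (Homeomorph.smulOfNeZero r hr.ne')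

lemma contDiff_comp_smul {f : E → G} (hf : ContDiff ℝ ∞ f) (r : ℝ) :
    ContDiff ℝ ∞ fun x => f (r • x) :=
  hf.comp (contDiff_const_smul r)

section

variable [Nontrivial E] {a : ℝ} (h1 : (finrank ℝ E : ℝ) < a) (h2 : a < finrank ℝ E + 2)

include h1 h2

lemma exists_bumpLap_le : ∃ C, 0 ≤ C ∧ ∀ x : E, |bumpLap a x| ≤ C * (1 + ‖x‖) ^ (-a) :=
  exists_norm_hyperInt_le h1 h2 contDiff_radialBump hasCompactSupport_radialBump
    fun _ => radialBump_eq_zero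

lemma continuous_bumpLap : Continuous (bumpLap a : E → ℝ) :=
  continuous_hyperInt h1 h2 contDiff_radialBump hasCompactSupport_radialBump

lemma integrable_bumpLap : Integrable (bumpLap a : E → ℝ) := by
  obtain ⟨C, -, hC⟩ := exists_bumpLap_le (E := E) h1 h2
  exact ((integrable_one_add_norm h1).const_mul C).mono'
    (continuous_bumpLap h1 h2).aestronglyMeasurable (.of_forall hC)

/-- Pair with the dilated bump `b(r·)` and let `r → 0`: the pairing tends to `b(0) ∫ L b`, while
symmetry and scaling bound it by `O(r^(a-N))`. -/
lemma integral_bumpLap : ∫ x : E, bumpLap a x = 0 := by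
  obtain ⟨C, hC0, hC⟩ := exists_bumpLap_le (E := E) h1 h2
  have ha : 0 < a := lt_of_le_of_lt (by positivity) h1
  have hC' : ∀ x : E, |bumpLap a x| ≤ C := fun x => (hC x).trans
    (mul_le_of_le_one_right hC0 (Real.rpow_le_one_of_one_le_of_nonpos (by simp) (by linarith)))
  have hbi : Integrable (radialBump : E → ℝ) :=
    contDiff_radialBump.continuous.integrable_of_hasCompactSupport hasCompactSupport_radialBump
  have key : ∀ r : ℝ, 0 < r → ∫ x : E, bumpLap a x * radialBump (r • x)
      = r ^ (a - finrank ℝ E) * ∫ x : E, radialBump x * bumpLap a (r • x) := by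
    intro r hr
    have := integral_mul_hyperInt h1 h2 (contDiff_radialBump (E := E)) hasCompactSupport_radialBump
      (contDiff_comp_smul (contDiff_radialBump (E := E)) r)
      (hasCompactSupport_comp_smul hasCompactSupport_radialBump hr)
    simp only [bumpLap_dilation a hr] at this
    rw [← integral_const_mul]
    refine this.symm.trans ?_
    congr! 2 with x
    ring
  have lim1 : Tendsto (fun r : ℝ => ∫ x : E, bumpLap a x * radialBump (r • x)) (𝓝[>] 0)
      (𝓝 (∫ x : E, bumpLap a x * radialBump (0 : E))) := by
    refine tendsto_integral_filter_of_dominated_convergence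
      (fun x => ‖bumpLap a x‖ * radialBump (0 : E)) (.of_forall fun r => ?_)
      (.of_forall fun r => .of_forall fun x => ?_)
      ((integrable_bumpLap h1 h2).norm.mul_const _) (.of_forall fun x => ?_)
    · exact ((continuous_bumpLap h1 h2).mul
        (contDiff_comp_smul contDiff_radialBump r).continuous).aestronglyMeasurable
    · rw [norm_mul, Real.norm_of_nonneg (radialBump_nonneg _)]
      exact mul_le_mul_of_nonneg_left (radialBump_anti (by simp)) (norm_nonneg _)
    · refine Tendsto.const_mul _ ?_
      have : Continuous fun r : ℝ => radialBump (r • x) :=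
        contDiff_radialBump.continuous.comp (by fun_prop)
      have h := this.tendsto 0
      rw [zero_smul] at h
      exact h.mono_left nhdsWithin_le_nhds
  have lim2 : Tendsto (fun r : ℝ => ∫ x : E, bumpLap a x * radialBump (r • x)) (𝓝[>] 0) (𝓝 0) := by
    refine squeeze_zero_norm' (a := fun r : ℝ => r ^ (a - finrank ℝ E) *
      (C * ∫ x : E, radialBump x)) ?_ ?_
    · filter_upwards [self_mem_nhdsWithin] with r (hr : 0 < r)
      rw [key r hr, norm_mul, Real.norm_of_nonneg (by positivity), ← integral_const_mul]
      gcongr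
      refine norm_integral_le_of_norm_le (hbi.const_mul C) (.of_forall fun x => ?_)
      rw [norm_mul, Real.norm_of_nonneg (radialBump_nonneg _), mul_comm]
      exact mul_le_mul_of_nonneg_right (hC' _) (radialBump_nonneg _)
    · have : Tendsto (fun r : ℝ => r ^ (a - finrank ℝ E)) (𝓝[>] 0) (𝓝 0) := by
        have := (Real.continuousAt_rpow_const 0 (a - finrank ℝ E)
          (Or.inr (by linarith))).tendsto
        rw [Real.zero_rpow (by linarith)] at this
        exact this.mono_left nhdsWithin_le_nhds
      simpa using this.mul_const _
  have := tendsto_nhds_unique lim1 lim2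
  rw [integral_mul_const] at this
  exact (mul_eq_zero.1 this).resolve_right radialBump_zero_pos.ne'

lemma integrableOn_Ioi_bumpLap {x : E} (hx : x ≠ 0) :
    IntegrableOn (fun t : ℝ => t ^ (finrank ℝ E - 1) * bumpLap a (t • x)) (Ioi 0) := by
  have hx' : ‖x‖ ≠ 0 := norm_ne_zero_iff.2 hx
  refine (integrable_fun_norm_addHaar (E := E) volume (f := fun t => bumpLap a (t • x))).1 ?_
  have : (fun y : E => bumpLap a (‖y‖ • x)) = fun y => bumpLap a (‖x‖ • y) := by
    ext y; exact bumpLap_eq_of_norm_eq a (by simp [norm_smul, mul_comm])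
  rw [this]
  exact (integrable_bumpLap h1 h2).comp_smul hx'

lemma integral_Ioi_bumpLap (x : E) :
    ∫ t in Ioi (0 : ℝ), t ^ (finrank ℝ E - 1) * bumpLap a (t • x) = 0 := by
  have hp := integral_fun_norm_addHaar (E := E) volume (fun t => bumpLap a (t • x))
  have : (fun y : E => bumpLap a (‖y‖ • x)) = fun y => bumpLap a (‖x‖ • y) := by
    ext y; exact bumpLap_eq_of_norm_eq a (by simp [norm_smul, mul_comm])
  rw [this, Measure.integral_comp_smul, integral_bumpLap h1 h2, smul_zero] at hp
  have hv : 0 < volume.real (ball (0 : E) 1) :=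
    ENNReal.toReal_pos (measure_ball_pos _ _ one_pos).ne' measure_ball_lt_top.ne
  have hd : (finrank ℝ E : ℕ) ≠ 0 := finrank_pos.ne'
  simpa [hd, hv.ne'] using hp

/-- The bump is maximal at the origin, so the integrand is nonnegative, and it is strictly positive
for `|y| > 1`. -/
lemma bumpLap_zero_pos : 0 < bumpLap a (0 : E) := by
  obtain ⟨M, -, hM⟩ := exists_norm_secondDiff_le (contDiff_radialBump (E := E))
    hasCompactSupport_radialBump
  have hint := integrable_hyperInt h1 h2 contDiff_radialBump.continuous hM (0 : E)
  refine (integral_pos_iff_support_of_nonneg (fun y => ?_) hint).2 ?_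
  · have e1 : radialBump y ≤ radialBump (0 : E) := radialBump_anti (by simp)
    have e2 : radialBump (-y) ≤ radialBump (0 : E) := radialBump_anti (by simp)
    simp only [secondDiff, smul_eq_mul, zero_add, zero_sub, Pi.zero_apply]
    exact mul_nonneg (by positivity) (by linarith)
  · have hopen : IsOpen {y : E | 1 < ‖y‖} := isOpen_lt continuous_const continuous_norm
    obtain ⟨y, hy⟩ := NormedSpace.exists_lt_norm ℝ E 1
    refine (hopen.measure_pos volume ⟨y, hy⟩).trans_le (measure_mono fun z (hz : 1 < ‖z‖) => ?_)
    have hz0 : 0 < ‖z‖ := one_pos.trans hz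
    have e1 : radialBump z = 0 := radialBump_eq_zero hz.le
    have e2 : radialBump (-z) = 0 := radialBump_eq_zero (by simpa using hz.le)
    have := radialBump_zero_pos (E := E)
    simp only [Function.mem_support, secondDiff, smul_eq_mul, zero_add, zero_sub, e1, e2]
    exact (mul_pos (inv_pos.2 (Real.rpow_pos_of_pos hz0 a)) (by linarith)).ne'

/-- Integrate over the ball before integrating in `y`: moving a radially decreasing function off
centre can only lower its integral over the ball. -/
lemma setIntegral_closedBall_hyperInt_nonneg {f : E → ℝ} (hf : ContDiff ℝ ∞ f)
    (hfc : HasCompactSupport f) (hanti : ∀ x y, ‖x‖ ≤ ‖y‖ → f y ≤ f x) :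
    0 ≤ ∫ x in closedBall (0 : E) 1, hyperInt a f x := by
  obtain ⟨M, hM0, hM⟩ := exists_norm_secondDiff_le hf hfc
  obtain ⟨e, he⟩ : ∃ e : E, ‖e‖ = 1 := exists_norm_eq E zero_le_one
  have hfi : Integrable f := hf.continuous.integrable_of_hasCompactSupport hfc
  have hfin : IsFiniteMeasure (volume.restrict (closedBall (0 : E) 1)) :=
    ⟨by simpa using measure_closedBall_lt_top⟩
  have hint : Integrable (fun p : E × E => (‖p.2‖ ^ a)⁻¹ • secondDiff f p.1 p.2)
      ((volume.restrict (closedBall (0 : E) 1)).prod volume) := by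
    refine ((integrable_const (1 : ℝ)).mul_prod ((integrable_kerMin h1 h2).const_mul M)).mono' ?_
      (.of_forall fun p => ?_)
    · have hk : AEStronglyMeasurable (fun p : E × E => (‖p.2‖ ^ a)⁻¹)
          ((volume.restrict (closedBall (0 : E) 1)).prod volume) :=
        ((measurable_kernel a).comp measurable_snd).aestronglyMeasurable
      exact hk.smul (continuous_secondDiff hf.continuous).aestronglyMeasurable
    · rw [one_mul]
      exact norm_kernel_smul_secondDiff_le hM p.1 p.2
  have htr : ∀ y : E, ∫ x in closedBall (0 : E) 1, f (x + y) ≤ ∫ x in closedBall (0 : E) 1, f x := by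
    intro y
    have hm : MeasurableSet (closedBall (0 : E) 1) := measurableSet_closedBall
    have hgi : ∀ z : E, Integrable ((closedBall (0 : E) 1).indicator fun x => f (x + z) - f e) :=
      fun z => (integrable_indicator_iff hm).2
        ((hfi.comp_add_right z).integrableOn.sub (integrable_const _))
    -- After subtracting the value on the unit sphere, `f` is nonnegative inside the ball and
    -- nonpositive outside, so among translates of the ball the centred one captures most, even
    -- pointwise.
    have hle : ∫ x, (closedBall (0 : E) 1).indicator (fun x => f (x + y) - f e) x
        ≤ ∫ x, (closedBall (0 : E) 1).indicator (fun x => f (x + 0) - f e) x := by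
      rw [← integral_sub_right_eq_self _ y]
      refine integral_mono ((hgi y).comp_sub_right y) (hgi 0) fun z => ?_
      simp only [indicator, sub_add_cancel, add_zero, mem_closedBall_zero_iff]
      by_cases hz : ‖z‖ ≤ 1
      · have := hanti z e (by rw [he]; exact hz)
        simp only [hz, if_true]
        split_ifs <;> linarith
      · have := hanti e z (by rw [he]; exact (not_le.1 hz).le)
        simp only [hz, if_false]
        split_ifs <;> linarith
    rw [integral_indicator hm, integral_indicator hm,
      integral_sub (hfi.comp_add_right y).integrableOn (integrable_const _),
      integral_sub (hfi.comp_add_right 0).integrableOn (integrable_const _)] at hle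
    simpa using hle
  simp only [hyperInt]
  rw [integral_integral_swap hint]
  refine integral_nonneg fun y => ?_
  simp only [smul_eq_mul, Pi.zero_apply]
  rw [integral_const_mul]
  refine mul_nonneg (by positivity) ?_
  have i0 : IntegrableOn f (closedBall (0 : E) 1) := hfi.integrableOn
  have e : ∫ x in closedBall (0 : E) 1, secondDiff f x y
      = 2 * (∫ x in closedBall (0 : E) 1, f x) - (∫ x in closedBall (0 : E) 1, f (x + y))
        - ∫ x in closedBall (0 : E) 1, f (x + -y) := by
    have i1 : ∀ y, IntegrableOn (fun x => f (x + y)) (closedBall (0 : E) 1) :=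
      fun y => (hfi.comp_add_right y).integrableOn
    rw [← integral_const_mul, ← integral_sub (i0.const_mul 2) (i1 y)]
    refine Eq.trans ?_ (integral_sub ((i0.const_mul 2).sub (i1 y)) (i1 (-y)))
    congr! 2 with x
    simp only [secondDiff, smul_eq_mul, sub_eq_add_neg]
  rw [e]
  linarith [htr y, htr (-y)]

end

/-! ### Averages over dilations -/

/-- The average of the dilations of `h` over scales in `(0, 1]`, with density `ρ ^ j`. -/
def dilInt (j : ℕ) (h : E → G) (x : E) : G := ∫ ρ in Ioc (0 : ℝ) 1, ρ ^ j • h (ρ • x)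

lemma integrableOn_dilInt {j : ℕ} {h : E → G} (hc : Continuous h) (x : E) :
    IntegrableOn (fun ρ : ℝ => ρ ^ j • h (ρ • x)) (Ioc 0 1) :=
  (Continuous.integrableOn_Icc (by fun_prop)).mono_set Ioc_subset_Icc_self

lemma norm_dilInt_le {j : ℕ} {h : E → G} {C : ℝ} (hC : ∀ x, ‖h x‖ ≤ C) (x : E) :
    ‖dilInt j h x‖ ≤ C := by
  have hC0 : 0 ≤ C := (norm_nonneg _).trans (hC 0)
  have := norm_setIntegral_le_of_norm_le_const (μ := volume) (s := Ioc (0 : ℝ) 1)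
    (f := fun ρ : ℝ => ρ ^ j • h (ρ • x)) (C := C) (by simp) fun ρ hρ => by
      rw [norm_smul, norm_pow, Real.norm_of_nonneg hρ.1.le]
      exact (mul_le_mul (pow_le_one₀ hρ.1.le hρ.2) (hC _) (norm_nonneg _) zero_le_one).trans
        (one_mul C).le
  simpa [dilInt] using this

/-- The chain rule gives one extra factor `ρ` per derivative. This gain is what later makes the
direct decay estimate available for second derivatives. -/
lemma hasFDerivAt_dilInt {j : ℕ} {h : E → G} {h' : E → E →L[ℝ] G} {C : ℝ}
    (hh : ∀ x, HasFDerivAt h (h' x) x) (hc : Continuous h') (hC : ∀ x, ‖h' x‖ ≤ C) (x : E) :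
    HasFDerivAt (dilInt j h) (dilInt (j + 1) h' x) x := by
  have hC0 : 0 ≤ C := (norm_nonneg _).trans (hC 0)
  have hcont : Continuous h := continuous_iff_continuousAt.2 fun x => (hh x).continuousAt
  refine hasFDerivAt_integral_of_dominated_of_fderiv_le (s := univ) (bound := fun _ => C)
    (F' := fun x ρ => ρ ^ (j + 1) • h' (ρ • x)) univ_mem
    (.of_forall fun x => (integrableOn_dilInt hcont x).aestronglyMeasurable)
    (integrableOn_dilInt hcont x) (integrableOn_dilInt hc x).aestronglyMeasurable
    ((ae_restrict_iff' measurableSet_Ioc).2 (.of_forall fun ρ hρ x _ => ?_))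
    (integrable_const _) (.of_forall fun ρ x _ => ?_)
  · rw [norm_smul, norm_pow, Real.norm_of_nonneg hρ.1.le]
    exact (mul_le_mul (pow_le_one₀ hρ.1.le hρ.2) (hC _) (norm_nonneg _) zero_le_one).trans
      (one_mul C).le
  · have e : HasFDerivAt (fun x : E => ρ • x) (ρ • ContinuousLinearMap.id ℝ E) x :=
      (hasFDerivAt_id x).const_smul ρ
    have := ((hh (ρ • x)).comp x e).const_smul (ρ ^ j)
    rw [ContinuousLinearMap.comp_smul, ContinuousLinearMap.comp_id, smul_smul, ← pow_succ] at this
    exact this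

/-- Decay at `ρ • x` costs a factor `ρ^(-a)`, and `ρ^(j-a)` is integrable at zero because `a < j +
1`. -/
lemma exists_norm_dilInt_le {a : ℝ} (ha : 0 ≤ a) {j : ℕ} (hj : a < j + 1) {h : E → G} {C : ℝ}
    (hC0 : 0 ≤ C) (hC : ∀ x, ‖h x‖ ≤ C * (1 + ‖x‖) ^ (-a)) :
    ∃ C', 0 ≤ C' ∧ ∀ x, ‖dilInt j h x‖ ≤ C' * (1 + ‖x‖) ^ (-a) := by
  have hi : IntegrableOn (fun ρ : ℝ => ρ ^ ((j : ℝ) - a)) (Ioc 0 1) := by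
    rw [← intervalIntegrable_iff_integrableOn_Ioc_of_le zero_le_one]
    exact intervalIntegral.intervalIntegrable_rpow' (by linarith)
  refine ⟨C * ∫ ρ in Ioc (0 : ℝ) 1, ρ ^ ((j : ℝ) - a), mul_nonneg hC0
    (setIntegral_nonneg measurableSet_Ioc fun ρ hρ => Real.rpow_nonneg hρ.1.le _), fun x => ?_⟩
  rw [mul_right_comm, ← integral_const_mul]
  refine norm_integral_le_of_norm_le (hi.const_mul _)
    ((ae_restrict_iff' measurableSet_Ioc).2 (.of_forall fun ρ hρ => ?_))
  rw [norm_smul, norm_pow, Real.norm_of_nonneg hρ.1.le, sub_eq_add_neg, Real.rpow_add hρ.1,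
    Real.rpow_natCast]
  calc ρ ^ j * ‖h (ρ • x)‖ ≤ ρ ^ j * (C * (ρ ^ (-a) * (1 + ‖x‖) ^ (-a))) := by
        have hρ0 : 0 ≤ ρ := hρ.1.le
        gcongr
        refine (hC _).trans ?_
        gcongr
        exact one_add_norm_smul_rpow_neg_le ha hρ.1 hρ.2 x
    _ = _ := by ring

/-- A function whose values and second derivatives decay has a decaying first derivative. -/
lemma exists_norm_fderiv_le_of_decay {a : ℝ} (ha : 0 ≤ a) {f : E → G} {f' : E → E →L[ℝ] G}
    {f'' : E → E →L[ℝ] E →L[ℝ] G} (hf : ∀ x, HasFDerivAt f (f' x) x)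
    (hf' : ∀ x, HasFDerivAt f' (f'' x) x) {C : ℝ} (hC0 : 0 ≤ C)
    (h0 : ∀ x, ‖f x‖ ≤ C * (1 + ‖x‖) ^ (-a)) (h2 : ∀ x, ‖f'' x‖ ≤ C * (1 + ‖x‖) ^ (-a)) :
    ∃ C', 0 ≤ C' ∧ ∀ x, ‖f' x‖ ≤ C' * (1 + ‖x‖) ^ (-a) := by
  refine ⟨C * 2 ^ a + C + C * 2 ^ a, by positivity, fun x => ?_⟩
  have hw : ∀ z ∈ closedBall x 1, (1 + ‖z‖) ^ (-a) ≤ 2 ^ a * (1 + ‖x‖) ^ (-a) := by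
    intro z hz
    have := one_add_norm_sub_rpow_neg_le ha (x - z) x
    rw [sub_sub_cancel_left, norm_neg] at this
    refine this.trans ?_
    rw [mem_closedBall, dist_comm, dist_eq_norm] at hz
    gcongr
    linarith
  set W := (1 + ‖x‖) ^ (-a)
  have hW : 0 ≤ W := by positivity
  refine ContinuousLinearMap.opNorm_le_of_unit_norm (by positivity) fun v hv => ?_
  have hxv : x + v ∈ closedBall x 1 := by simp [hv]
  have hx : x ∈ closedBall x 1 := by simp
  have d1 : ∀ z ∈ closedBall x 1, ‖f' z - f' x‖ ≤ C * (2 ^ a * W) := by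
    intro z hz
    have := (convex_closedBall x 1).norm_image_sub_le_of_norm_hasFDerivWithin_le
      (fun z _ => (hf' z).hasFDerivWithinAt)
      (fun z hz => (h2 z).trans (mul_le_mul_of_nonneg_left (hw z hz) hC0)) hx hz
    rw [mem_closedBall, dist_eq_norm] at hz
    exact this.trans (mul_le_of_le_one_right (by positivity) hz)
  -- Taylor's formula with unit step: `f' x v` is `f (x + v) - f x` up to the oscillation of `f'` on
  -- the unit ball around `x`, which `f''` controls.
  have d2 := (convex_closedBall x 1).norm_image_sub_le_of_norm_hasFDerivWithin_le'
    (fun z _ => (hf z).hasFDerivWithinAt) d1 hx hxv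
  rw [add_sub_cancel_left, hv, mul_one] at d2
  have d3 := (h0 (x + v)).trans (mul_le_mul_of_nonneg_left (hw _ hxv) hC0)
  calc ‖f' x v‖ = ‖f (x + v) - f x - (f (x + v) - f x - f' x v)‖ := by congr 1; abel
    _ ≤ ‖f (x + v)‖ + ‖f x‖ + ‖f (x + v) - f x - f' x v‖ :=
        (norm_sub_le _ _).trans (add_le_add_left (norm_sub_le _ _) _)
    _ ≤ C * (2 ^ a * W) + C * W + C * (2 ^ a * W) := add_le_add_three d3 (h0 x) d2
    _ = _ := by ring

/-! ### The reproducing kernel: decay, derivatives and positive mass -/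

/-- The kernel for which convolution reproduces solutions, up to a constant factor. -/
def resKer (a : ℝ) : E → ℝ := dilInt (finrank ℝ E - 1) (bumpLap a)

section

variable [Nontrivial E] {a : ℝ} (h1 : (finrank ℝ E : ℝ) < a) (h2 : a < finrank ℝ E + 2)

include h1 h2

/-- Direct estimation fails, since `ρ^(N-1-a)` is not integrable at zero. Because the full ray
integral over `(0, ∞)` vanishes, the kernel equals minus the integral over `(1, ∞)`, where that
power is integrable. -/
lemma exists_resKer_le : ∃ C, 0 ≤ C ∧ ∀ x : E, |resKer a x| ≤ C * (1 + ‖x‖) ^ (-a) := by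
  obtain ⟨C, hC0, hC⟩ := exists_bumpLap_le (E := E) h1 h2
  have ha : 0 < a := lt_of_le_of_lt (by positivity) h1
  have hd : 0 < finrank ℝ E := finrank_pos
  have hd' : ((finrank ℝ E - 1 : ℕ) : ℝ) = (finrank ℝ E : ℝ) - 1 := by
    rw [Nat.cast_sub hd]; simp
  have hC' : ∀ x : E, ‖bumpLap a x‖ ≤ C := fun x => (hC x).trans
    (mul_le_of_le_one_right hC0 (Real.rpow_le_one_of_one_le_of_nonpos (by simp) (by linarith)))
  have hi : IntegrableOn (fun ρ : ℝ => ρ ^ ((finrank ℝ E : ℝ) - 1 - a)) (Ioi 1) :=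
    integrableOn_Ioi_rpow_of_lt (by linarith) one_pos
  set I := ∫ ρ in Ioi (1 : ℝ), ρ ^ ((finrank ℝ E : ℝ) - 1 - a)
  have hI : 0 ≤ I := setIntegral_nonneg measurableSet_Ioi fun ρ hρ =>
    Real.rpow_nonneg (zero_le_one.trans (le_of_lt hρ)) _
  refine ⟨2 ^ a * (C + C * I), by positivity, fun x => ?_⟩
  have hx0 : 0 < 1 + ‖x‖ := by positivity
  rw [Real.rpow_neg hx0.le, ← div_eq_mul_inv, le_div_iff₀ (by positivity)]
  rcases le_total ‖x‖ 1 with hx | hx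
  · have : |resKer a x| ≤ C := norm_dilInt_le hC' x
    calc |resKer a x| * (1 + ‖x‖) ^ a ≤ C * 2 ^ a := by
          gcongr
          linarith
      _ ≤ _ := by nlinarith [Real.rpow_nonneg (zero_le_two (α := ℝ)) a, mul_nonneg hC0 hI,
          mul_nonneg (Real.rpow_nonneg (zero_le_two (α := ℝ)) a) (mul_nonneg hC0 hI)]
  · have hxp : 0 < ‖x‖ := one_pos.trans_le hx
    have hxne : x ≠ 0 := norm_pos_iff.1 hxp
    have hio := integrableOn_Ioi_bumpLap (E := E) h1 h2 hxne
    have hz := integral_Ioi_bumpLap h1 h2 x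
    rw [← Ioc_union_Ioi_eq_Ioi (zero_le_one' ℝ)] at hio hz
    rw [setIntegral_union (by
      rw [Set.disjoint_left]; exact fun t ht ht' => not_lt.2 ht.2 ht') measurableSet_Ioi
      (hio.mono_set subset_union_left) (hio.mono_set subset_union_right)] at hz
    have hK : resKer a x = -∫ t in Ioi (1 : ℝ), t ^ (finrank ℝ E - 1) * bumpLap a (t • x) :=
      eq_neg_of_add_eq_zero_left hz
    have hb : |resKer a x| ≤ C * ‖x‖ ^ (-a) * I := by
      rw [hK, abs_neg, ← integral_const_mul, ← Real.norm_eq_abs]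
      refine norm_integral_le_of_norm_le (hi.const_mul _)
        ((ae_restrict_iff' measurableSet_Ioi).2 (.of_forall fun t (ht : 1 < t) => ?_))
      have ht0 : 0 < t := one_pos.trans ht
      rw [norm_mul, norm_pow, Real.norm_of_nonneg ht0.le, sub_eq_add_neg, ← hd', Real.rpow_add ht0,
        Real.rpow_natCast]
      calc t ^ (finrank ℝ E - 1) * ‖bumpLap a (t • x)‖
          ≤ t ^ (finrank ℝ E - 1) * (C * (t ^ (-a) * ‖x‖ ^ (-a))) := by
            gcongr
            refine (hC _).trans ?_
            gcongr
            rw [← Real.mul_rpow ht0.le hxp.le, norm_smul, Real.norm_of_nonneg ht0.le]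
            exact Real.rpow_le_rpow_of_nonpos (by positivity) (by linarith) (by linarith)
        _ = _ := by ring
    calc |resKer a x| * (1 + ‖x‖) ^ a ≤ (C * ‖x‖ ^ (-a) * I) * (2 * ‖x‖) ^ a := by
          gcongr
          linarith
      _ = 2 ^ a * (C * I) := by
          rw [Real.mul_rpow zero_le_two hxp.le, Real.rpow_neg hxp.le]
          field_simp
      _ ≤ _ := by gcongr; linarith

/-- The first two derivatives of the reproducing kernel exist and decay like the kernel. -/
lemma exists_fderiv_resKer : ∃ (K' : E → E →L[ℝ] ℝ) (K'' : E → E →L[ℝ] E →L[ℝ] ℝ) (C : ℝ),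
    0 ≤ C ∧ (∀ x, HasFDerivAt (resKer a) (K' x) x) ∧ (∀ x, HasFDerivAt K' (K'' x) x) ∧
    Continuous K'' ∧ (∀ x : E, ‖resKer a x‖ ≤ C * (1 + ‖x‖) ^ (-a)) ∧
    (∀ x, ‖K' x‖ ≤ C * (1 + ‖x‖) ^ (-a)) ∧ (∀ x, ‖K'' x‖ ≤ C * (1 + ‖x‖) ^ (-a)) := by
  have ha : 0 < a := lt_of_le_of_lt (by positivity) h1
  have hd : 0 < finrank ℝ E := finrank_pos
  have hb := contDiff_radialBump (E := E)
  have hbc := hasCompactSupport_radialBump (E := E)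
  have hb1 := contDiff_infty_fderiv hb
  have hb2 := contDiff_infty_fderiv hb1
  have hbc1 := hbc.fderiv (𝕜 := ℝ)
  have hbc2 := hbc1.fderiv (𝕜 := ℝ)
  -- The support gives vanishing only for `|x| > 1`; the unit sphere is reached by continuity along
  -- `t • x`, `t ↓ 1`.
  have hz : ∀ x : E, 1 ≤ ‖x‖ → fderiv ℝ (fderiv ℝ radialBump) x = 0 := by
    have hs : tsupport (fderiv ℝ (fderiv ℝ (radialBump : E → ℝ))) ⊆ tsupport radialBump :=
      (tsupport_fderiv_subset ℝ).trans (tsupport_fderiv_subset ℝ)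
    have h0 : ∀ x : E, 1 < ‖x‖ → fderiv ℝ (fderiv ℝ radialBump) x = 0 := by
      intro x hx
      refine image_eq_zero_of_notMem_tsupport fun hxs => ?_
      have : tsupport (radialBump : E → ℝ) ⊆ closedBall 0 1 :=
        closure_minimal (fun z hz => by
          by_contra h
          rw [mem_closedBall_zero_iff, not_le] at h
          exact hz (radialBump_eq_zero h.le)) isClosed_closedBall
      exact absurd (mem_closedBall_zero_iff.1 (this (hs hxs))) (not_le.2 hx)
    intro x hx
    have hcl : closure {x : E | 1 < ‖x‖} ⊆ {x | fderiv ℝ (fderiv ℝ radialBump) x = 0} :=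
      closure_minimal h0 (isClosed_eq hb2.continuous continuous_const)
    refine hcl (mem_closure_of_tendsto (f := fun t : ℝ => t • x) (b := 𝓝[>] 1) ?_ ?_)
    · have : Continuous fun t : ℝ => t • x := by fun_prop
      have h := this.tendsto 1
      rw [one_smul] at h
      exact h.mono_left nhdsWithin_le_nhds
    · filter_upwards [self_mem_nhdsWithin] with t (ht : 1 < t)
      rw [norm_smul, Real.norm_of_nonneg (by linarith)]
      nlinarith
  obtain ⟨M1, -, hM1⟩ := exists_norm_secondDiff_le hb1 hbc1
  obtain ⟨M2, -, hM2⟩ := exists_norm_secondDiff_le hb2 hbc2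
  obtain ⟨D, hD0, hD⟩ := exists_norm_hyperInt_le h1 h2 hb2 hbc2 hz
  -- Two derivatives raise the power of `ρ` to `N + 1`, and `a < N + 2` is then exactly the
  -- condition required.
  obtain ⟨D2, hD20, hD2⟩ := exists_norm_dilInt_le ha.le (j := finrank ℝ E - 1 + 1 + 1) (by
    rw [Nat.sub_add_cancel hd]; push_cast; linarith) hD0 hD
  obtain ⟨C0, hC00, hC0⟩ := exists_resKer_le (E := E) h1 h2
  have e1 : ∀ x, HasFDerivAt (resKer a) (dilInt (finrank ℝ E - 1 + 1)
      (hyperInt a (fderiv ℝ radialBump)) x) x :=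
    hasFDerivAt_dilInt (hasFDerivAt_hyperInt h1 h2 hb hbc) (continuous_hyperInt h1 h2 hb1 hbc1)
      (norm_hyperInt_le h1 h2 hM1)
  have hcont2 := continuous_hyperInt h1 h2 hb2 hbc2
  have e2 := hasFDerivAt_dilInt (j := finrank ℝ E - 1 + 1) (hasFDerivAt_hyperInt h1 h2 hb1 hbc1)
    hcont2 (norm_hyperInt_le h1 h2 hM2)
  have hm0 : ∀ x : E, ‖resKer a x‖ ≤ max C0 D2 * (1 + ‖x‖) ^ (-a) := fun x =>
    (hC0 x).trans (by gcongr; exact le_max_left _ _)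
  have hm2 : ∀ x : E, ‖dilInt (finrank ℝ E - 1 + 1 + 1) (hyperInt a (fderiv ℝ
      (fderiv ℝ radialBump))) x‖ ≤ max C0 D2 * (1 + ‖x‖) ^ (-a) := fun x =>
    (hD2 x).trans (by gcongr; exact le_max_right _ _)
  have hmax : 0 ≤ max C0 D2 := hC00.trans (le_max_left _ _)
  -- With one derivative the power is only `N`, insufficient when `a ≥ N + 1`; decay of `K'` is
  -- therefore interpolated between `K` and `K''`.
  obtain ⟨C1, hC10, hC1⟩ := exists_norm_fderiv_le_of_decay ha.le e1 e2 hmax hm0 hm2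
  refine ⟨_, _, max (max C0 D2) C1, hmax.trans (le_max_left _ _), e1, e2, ?_,
    fun x => (hm0 x).trans (mul_le_mul_of_nonneg_right (le_max_left _ _) (by positivity)),
    fun x => (hC1 x).trans (mul_le_mul_of_nonneg_right (le_max_right _ _) (by positivity)),
    fun x => (hm2 x).trans (mul_le_mul_of_nonneg_right (le_max_left _ _) (by positivity))⟩
  refine continuous_of_dominated (bound := fun _ => M2 * ∫ y : E, kerMin a y)
    (fun x => (integrableOn_dilInt hcont2 x).aestronglyMeasurable)
    (fun x => (ae_restrict_iff' measurableSet_Ioc).2 (.of_forall fun ρ hρ => ?_))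
    (integrable_const _) (.of_forall fun ρ => by fun_prop)
  rw [norm_smul, norm_pow, Real.norm_of_nonneg hρ.1.le]
  have hh := norm_hyperInt_le h1 h2 hM2 (ρ • x)
  exact (mul_le_mul (pow_le_one₀ hρ.1.le hρ.2) hh (norm_nonneg _) zero_le_one).trans (one_mul _).le

lemma continuous_resKer : Continuous (resKer a : E → ℝ) := by
  obtain ⟨K', K'', C, -, h, -⟩ := exists_fderiv_resKer (E := E) h1 h2
  exact continuous_iff_continuousAt.2 fun x => (h x).continuousAt

lemma integrable_resKer : Integrable (resKer a : E → ℝ) := by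
  obtain ⟨C, -, hC⟩ := exists_resKer_le (E := E) h1 h2
  exact ((integrable_one_add_norm h1).const_mul C).mono'
    (continuous_resKer h1 h2).aestronglyMeasurable (.of_forall hC)

lemma resKer_zero_pos : 0 < resKer a (0 : E) := by
  have hd : 0 < finrank ℝ E := finrank_pos
  have h0 := bumpLap_zero_pos (E := E) h1 h2
  have : resKer a (0 : E) = (∫ ρ in (0 : ℝ)..1, ρ ^ (finrank ℝ E - 1)) * bumpLap a (0 : E) := by
    rw [intervalIntegral.integral_of_le zero_le_one, ← integral_mul_const]
    simp [resKer, dilInt]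
  rw [this, integral_pow]
  have : (0 : ℝ) < ((finrank ℝ E - 1 : ℕ) : ℝ) + 1 := by positivity
  simp only [one_pow, zero_pow (Nat.succ_ne_zero _), sub_zero]
  positivity

/-- By polar coordinates `N |B| K(x) = ∫_B (L b)(|x| y) dy`. The integrand is `|x|^(N-a)` times `L`
of the radially decreasing function `b(|x|·)`, whose integral over the ball is nonnegative. -/
lemma resKer_nonneg (x : E) : 0 ≤ resKer a x := by
  rcases eq_or_ne x 0 with rfl | hx
  · exact (resKer_zero_pos h1 h2).le
  have hxp : 0 < ‖x‖ := norm_pos_iff.2 hx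
  have hp := integral_fun_norm_addHaar (E := E) volume
    (fun t => (Iic (1 : ℝ)).indicator (fun t => bumpLap a (t • x)) t)
  have hl : ∫ y : E, (Iic (1 : ℝ)).indicator (fun t => bumpLap a (t • x)) ‖y‖
      = ∫ y in closedBall (0 : E) 1, bumpLap a (‖x‖ • y) := by
    rw [← integral_indicator measurableSet_closedBall]
    congr! 2 with y
    simp only [indicator, mem_Iic, mem_closedBall_zero_iff]
    congr 1
    exact bumpLap_eq_of_norm_eq a (by simp [norm_smul, mul_comm])
  have hr : ∫ t in Ioi (0 : ℝ), t ^ (finrank ℝ E - 1) •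
      (Iic (1 : ℝ)).indicator (fun t => bumpLap a (t • x)) t = resKer a x := by
    have hi : ∀ t : ℝ, t ^ (finrank ℝ E - 1) • (Iic (1 : ℝ)).indicator
        (fun t => bumpLap a (t • x)) t
        = (Iic (1 : ℝ)).indicator (fun t => t ^ (finrank ℝ E - 1) • bumpLap a (t • x)) t := by
      intro t
      by_cases ht : t ∈ Iic (1 : ℝ)
      · rw [indicator_of_mem ht, indicator_of_mem ht]
      · rw [indicator_of_notMem ht, indicator_of_notMem ht, smul_zero]
    simp only [hi]
    have := setIntegral_indicator (μ := volume) (s := Ioi (0 : ℝ)) (measurableSet_Iic (a := 1))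
      (f := fun t => t ^ (finrank ℝ E - 1) • bumpLap a (t • x))
    refine this.trans ?_
    rw [Ioi_inter_Iic]
    rfl
  rw [hl, hr] at hp
  have hnn := setIntegral_closedBall_hyperInt_nonneg h1 h2
    (contDiff_comp_smul (contDiff_radialBump (E := E)) ‖x‖)
    (hasCompactSupport_comp_smul hasCompactSupport_radialBump hxp)
    (fun y z hyz => radialBump_anti (by simp only [norm_smul, norm_norm]; gcongr))
  simp only [bumpLap_dilation a hxp] at hnn
  rw [integral_const_mul, hp] at hnn
  have hv : 0 < volume.real (ball (0 : E) 1) :=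
    ENNReal.toReal_pos (measure_ball_pos _ _ one_pos).ne' measure_ball_lt_top.ne
  have hd : (0 : ℝ) < finrank ℝ E := by exact_mod_cast finrank_pos
  rw [nsmul_eq_mul, smul_eq_mul] at hnn
  have := nonneg_of_mul_nonneg_right hnn (Real.rpow_pos_of_pos hxp _)
  exact nonneg_of_mul_nonneg_right (nonneg_of_mul_nonneg_right this hd) hv

lemma integral_resKer_pos : 0 < ∫ x : E, resKer a x := by
  refine (integral_pos_iff_support_of_nonneg (resKer_nonneg h1 h2) (integrable_resKer h1 h2)).2 ?_
  exact (continuous_resKer h1 h2).isOpen_support.measure_pos volume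
    ⟨0, (resKer_zero_pos h1 h2).ne'⟩

end

/-! ### Scaled kernels and truncated potentials -/

/-- The reproducing kernel at scale `T⁻¹`. -/
def scaledKer (a T : ℝ) (x : E) : ℝ := T ^ finrank ℝ E * resKer a (T • x)

/-- A truncated potential whose fractional Laplacian is, up to a constant, the difference of two
scaled reproducing kernels. -/
def truncPot (a T₀ T : ℝ) (x : E) : ℝ :=
  ∫ ρ in Ioc T₀ T, ρ ^ (finrank ℝ E - 1) * ρ ^ ((finrank ℝ E : ℝ) - a) * radialBump (ρ • x)

lemma integrableOn_truncPot_density (a : ℝ) {T₀ T : ℝ} (hT₀ : 0 < T₀) :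
    IntegrableOn (fun ρ : ℝ => ρ ^ (finrank ℝ E - 1) * ρ ^ ((finrank ℝ E : ℝ) - a))
      (Ioc T₀ T) := by
  refine (ContinuousOn.integrableOn_Icc ?_).mono_set Ioc_subset_Icc_self
  refine (continuous_pow _).continuousOn.mul fun ρ hρ => ?_
  exact (Real.continuousAt_rpow_const _ _
    (Or.inl (hT₀.trans_le hρ.1).ne')).continuousWithinAt

lemma continuous_truncPot (a : ℝ) {T₀ T : ℝ} (hT₀ : 0 < T₀) :
    Continuous (truncPot a T₀ T : E → ℝ) := by
  refine continuous_of_dominated (bound := fun ρ => ρ ^ (finrank ℝ E - 1) *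
    ρ ^ ((finrank ℝ E : ℝ) - a) * radialBump (0 : E)) (fun x => ?_)
    (fun x => (ae_restrict_iff' measurableSet_Ioc).2 (.of_forall fun ρ hρ => ?_))
    ((integrableOn_truncPot_density a hT₀).mul_const _) (.of_forall fun ρ => ?_)
  · exact (integrableOn_truncPot_density a hT₀).aestronglyMeasurable.mul
      (contDiff_radialBump.continuous.comp (by fun_prop)).aestronglyMeasurable
  · have hρ0 : 0 < ρ := hT₀.trans hρ.1
    rw [norm_mul, Real.norm_of_nonneg (radialBump_nonneg _), Real.norm_of_nonneg (by positivity)]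
    gcongr
    exact radialBump_anti (by simp)
  · exact continuous_const.mul (contDiff_radialBump.continuous.comp (by fun_prop))

lemma truncPot_eq_zero {a T₀ T : ℝ} (hT₀ : 0 < T₀) {x : E} (hx : T₀⁻¹ ≤ ‖x‖) :
    truncPot a T₀ T x = 0 := by
  rw [truncPot, setIntegral_congr_fun (g := fun _ => (0 : ℝ)) measurableSet_Ioc, integral_zero]
  intro ρ hρ
  have : radialBump (ρ • x) = 0 := radialBump_eq_zero (by
    rw [norm_smul, Real.norm_of_nonneg (hT₀.trans hρ.1).le]
    calc (1 : ℝ) = T₀ * T₀⁻¹ := (mul_inv_cancel₀ hT₀.ne').symm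
      _ ≤ ρ * ‖x‖ := mul_le_mul hρ.1.le hx (by positivity) (hT₀.trans hρ.1).le)
  simp [this]

section

variable [Nontrivial E] {a : ℝ} (h1 : (finrank ℝ E : ℝ) < a) (h2 : a < finrank ℝ E + 2)

include h1 h2

/-- Rescaling the kernel only moves the upper endpoint of the dilation integral, so a difference of
two scales is an integral over `(T₀, T]`. -/
lemma scaledKer_eq {T : ℝ} (hT : 0 < T) (x : E) :
    scaledKer a T x = ∫ ρ in (0 : ℝ)..T, ρ ^ (finrank ℝ E - 1) * bumpLap a (ρ • x) := by
  have hd : finrank ℝ E - 1 + 1 = finrank ℝ E := Nat.sub_add_cancel finrank_pos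
  have := intervalIntegral.integral_comp_mul_right (a := 0) (b := 1)
    (fun ρ : ℝ => ρ ^ (finrank ℝ E - 1) * bumpLap a (ρ • x)) hT.ne'
  rw [zero_mul, one_mul] at this
  have hs : ∫ ρ in (0 : ℝ)..T, ρ ^ (finrank ℝ E - 1) * bumpLap a (ρ • x)
      = T * ∫ ρ in (0 : ℝ)..1, (ρ * T) ^ (finrank ℝ E - 1) * bumpLap a ((ρ * T) • x) := by
    rw [this, smul_eq_mul, mul_inv_cancel_left₀ hT.ne']
  rw [hs, scaledKer, resKer, dilInt, intervalIntegral.integral_of_le zero_le_one,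
    ← integral_const_mul, ← integral_const_mul]
  congr! 2 with ρ
  rw [mul_pow, smul_smul, smul_eq_mul]
  nth_rewrite 1 [← hd]
  ring

lemma scaledKer_sub_scaledKer {T₀ T : ℝ} (hT₀ : 0 < T₀) (hT : T₀ ≤ T) (x : E) :
    scaledKer a T x - scaledKer a T₀ x
      = ∫ ρ in Ioc T₀ T, ρ ^ (finrank ℝ E - 1) * bumpLap a (ρ • x) := by
  have hc : Continuous fun ρ : ℝ => ρ ^ (finrank ℝ E - 1) * bumpLap a (ρ • x) :=
    (continuous_pow _).mul ((continuous_bumpLap h1 h2).comp (by fun_prop))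
  rw [scaledKer_eq h1 h2 (hT₀.trans_le hT), scaledKer_eq h1 h2 hT₀,
    intervalIntegral.integral_interval_sub_left (hc.intervalIntegrable _ _)
      (hc.intervalIntegrable _ _), intervalIntegral.integral_of_le hT]

lemma continuous_scaledKer (T : ℝ) : Continuous (scaledKer a T : E → ℝ) :=
  continuous_const.mul ((continuous_resKer h1 h2).comp (continuous_const_smul T))

/-- The distributional fractional Laplacian of the truncated potential. -/
lemma integral_truncPot_mul_hyperInt {T₀ T : ℝ} (hT₀ : 0 < T₀) (hT : T₀ ≤ T) (x : E) {ψ : E → ℝ}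
    (hψ : ContDiff ℝ ∞ ψ) (hψc : HasCompactSupport ψ) :
    ∫ y, truncPot a T₀ T (x - y) * hyperInt a ψ y
      = ∫ y, (scaledKer a T (x - y) - scaledKer a T₀ (x - y)) * ψ y := by
  obtain ⟨C, hC0, hC⟩ := exists_bumpLap_le (E := E) h1 h2
  have ha : 0 < a := lt_of_le_of_lt (by positivity) h1
  have hC' : ∀ x : E, |bumpLap a x| ≤ C := fun x => (hC x).trans
    (mul_le_of_le_one_right hC0 (Real.rpow_le_one_of_one_le_of_nonpos (by simp) (by linarith)))
  have hb := contDiff_radialBump (E := E)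
  have hLψ := continuous_hyperInt h1 h2 hψ hψc
  have hψi : Integrable ψ := hψ.continuous.integrable_of_hasCompactSupport hψc
  set w : ℝ → ℝ := fun ρ => ρ ^ (finrank ℝ E - 1) * ρ ^ ((finrank ℝ E : ℝ) - a)
  have hw : IntegrableOn w (Ioc T₀ T) := integrableOn_truncPot_density (E := E) a hT₀
  have hx : ∀ r : ℝ, 0 < r → HasCompactSupport fun y : E => radialBump (r • (x - y)) := fun r hr =>
    (hasCompactSupport_comp_smul hasCompactSupport_radialBump hr).comp_homeomorph
      (Homeomorph.subLeft x)
  have hxs : ∀ r : ℝ, ContDiff ℝ ∞ fun y : E => radialBump (r • (x - y)) := fun r =>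
    (contDiff_comp_smul hb r).comp (contDiff_const.sub contDiff_id)
  have F1 : Integrable (fun p : E × ℝ => w p.2 * radialBump (p.2 • (x - p.1)) * hyperInt a ψ p.1)
      (volume.prod (volume.restrict (Ioc T₀ T))) := by
    have hg : Integrable fun y => radialBump (T₀ • (x - y)) * hyperInt a ψ y :=
      ((hxs T₀).continuous.mul hLψ).integrable_of_hasCompactSupport (hx T₀ hT₀).mul_right
    refine (hg.norm.mul_prod hw.norm).mono' ?_ ?_
    · refine (hw.aestronglyMeasurable.comp_snd.mul
        (Continuous.aestronglyMeasurable ?_)).mul (hLψ.comp continuous_fst).aestronglyMeasurable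
      exact hb.continuous.comp (by fun_prop)
    · have : ∀ᵐ p : E × ℝ ∂(volume.prod (volume.restrict (Ioc T₀ T))), p.2 ∈ Ioc T₀ T :=
        Measure.quasiMeasurePreserving_snd.ae (ae_restrict_mem measurableSet_Ioc)
      filter_upwards [this] with p hp
      rw [norm_mul, norm_mul _ (radialBump _), norm_mul (radialBump _),
        Real.norm_of_nonneg (radialBump_nonneg _), Real.norm_of_nonneg (radialBump_nonneg _)]
      -- Since the bump is radially decreasing, the smallest dilation `T₀` dominates all the others.
      have : radialBump (p.2 • (x - p.1)) ≤ radialBump (T₀ • (x - p.1)) := radialBump_anti (by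
        rw [norm_smul, norm_smul, Real.norm_of_nonneg hT₀.le,
          Real.norm_of_nonneg (hT₀.trans hp.1).le]
        exact mul_le_mul_of_nonneg_right hp.1.le (norm_nonneg _))
      calc _ ≤ ‖w p.2‖ * radialBump (T₀ • (x - p.1)) * ‖hyperInt a ψ p.1‖ := by gcongr
        _ = _ := by ring
  have F2 : Integrable (fun p : E × ℝ => p.2 ^ (finrank ℝ E - 1) * bumpLap a (p.2 • (x - p.1)) *
      ψ p.1) (volume.prod (volume.restrict (Ioc T₀ T))) := by
    have hp : IntegrableOn (fun ρ : ℝ => ρ ^ (finrank ℝ E - 1) * C) (Ioc T₀ T) :=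
      (Continuous.integrableOn_Icc (by fun_prop)).mono_set Ioc_subset_Icc_self
    refine (hψi.norm.mul_prod hp.norm).mono' (Continuous.aestronglyMeasurable ?_)
      (.of_forall fun p => ?_)
    · exact ((continuous_snd.pow _).mul ((continuous_bumpLap h1 h2).comp (by fun_prop))).mul
        (hψ.continuous.comp continuous_fst)
    · rw [norm_mul, norm_mul, norm_mul, Real.norm_of_nonneg hC0, mul_comm]
      gcongr
      exact hC' _
  calc ∫ y, truncPot a T₀ T (x - y) * hyperInt a ψ y
      = ∫ y, ∫ ρ in Ioc T₀ T, w ρ * radialBump (ρ • (x - y)) * hyperInt a ψ y := by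
        congr! 2 with y
        rw [integral_mul_const]; rfl
    _ = ∫ ρ in Ioc T₀ T, ∫ y, w ρ * radialBump (ρ • (x - y)) * hyperInt a ψ y :=
        integral_integral_swap F1
    _ = ∫ ρ in Ioc T₀ T, ∫ y, ρ ^ (finrank ℝ E - 1) * bumpLap a (ρ • (x - y)) * ψ y := by
        refine setIntegral_congr_fun measurableSet_Ioc fun ρ hρ => ?_
        have hρ0 : 0 < ρ := hT₀.trans hρ.1
        have key := integral_mul_hyperInt h1 h2 (hxs ρ) (hx ρ hρ0) hψ hψc
        have e : ∀ y, hyperInt a (fun y : E => radialBump (ρ • (x - y))) y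
            = ρ ^ (a - finrank ℝ E) * bumpLap a (ρ • (x - y)) := fun y =>
          (hyperInt_comp_sub_left a (fun z : E => radialBump (ρ • z)) x y).trans
            (bumpLap_dilation a hρ0 (x - y))
        simp only [e] at key
        simp only [mul_assoc, integral_const_mul] at key ⊢
        rw [key]
        -- The factor `ρ^(N-a)` in the density is there to cancel the `ρ^(a-N)` produced by dilating
        -- the bump.
        simp only [w]
        rw [mul_assoc, ← mul_assoc (ρ ^ ((finrank ℝ E : ℝ) - a)), ← Real.rpow_add hρ0,
          show (finrank ℝ E : ℝ) - a + (a - finrank ℝ E) = 0 by ring, Real.rpow_zero, one_mul]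
    _ = ∫ y, ∫ ρ in Ioc T₀ T, ρ ^ (finrank ℝ E - 1) * bumpLap a (ρ • (x - y)) * ψ y :=
        (integral_integral_swap F2).symm
    _ = _ := by
        congr! 2 with y
        rw [integral_mul_const, scaledKer_sub_scaledKer h1 h2 hT₀ hT]

lemma exists_scaledKer_le : ∃ C, 0 ≤ C ∧ ∀ T : ℝ, 1 ≤ T → ∀ x : E,
    |scaledKer a T x| ≤ T ^ finrank ℝ E * C * (1 + ‖x‖) ^ (-a) := by
  obtain ⟨C, hC0, hC⟩ := exists_resKer_le (E := E) h1 h2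
  have ha : 0 < a := lt_of_le_of_lt (by positivity) h1
  refine ⟨C, hC0, fun T hT x => ?_⟩
  have hT0 : 0 < T := by linarith
  rw [scaledKer, abs_mul, abs_of_nonneg (by positivity), mul_assoc]
  gcongr
  refine (hC _).trans (mul_le_mul_of_nonneg_left
    (Real.rpow_le_rpow_of_nonpos (by positivity) ?_ (by linarith)) hC0)
  rw [norm_smul, Real.norm_of_nonneg (by linarith)]
  nlinarith [norm_nonneg x]

/-- Unlike `exists_scaledKer_le`, this bound is uniform in `T`: the scaling leaves `T^(N-a) ≤ 1`.
The price is the singularity at the origin. -/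
lemma exists_scaledKer_le_norm_rpow : ∃ C, 0 ≤ C ∧ ∀ T : ℝ, 1 ≤ T → ∀ x : E, x ≠ 0 →
    |scaledKer a T x| ≤ C * ‖x‖ ^ (-a) := by
  obtain ⟨C, hC0, hC⟩ := exists_resKer_le (E := E) h1 h2
  have ha : 0 < a := lt_of_le_of_lt (by positivity) h1
  refine ⟨C, hC0, fun T hT x hx => ?_⟩
  have hT0 : 0 < T := by linarith
  have hxp : 0 < ‖x‖ := norm_pos_iff.2 hx
  rw [scaledKer, abs_mul, abs_of_nonneg (by positivity)]
  calc T ^ finrank ℝ E * |resKer a (T • x)|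
      ≤ T ^ finrank ℝ E * (C * (T ^ (-a) * ‖x‖ ^ (-a))) := by
        gcongr
        refine (hC _).trans ?_
        gcongr
        rw [← Real.mul_rpow hT0.le hxp.le, norm_smul, Real.norm_of_nonneg hT0.le]
        exact Real.rpow_le_rpow_of_nonpos (by positivity) (by linarith) (by linarith)
    _ = T ^ ((finrank ℝ E : ℝ) - a) * (C * ‖x‖ ^ (-a)) := by
        rw [sub_eq_add_neg, Real.rpow_add hT0, Real.rpow_natCast]; ring
    _ ≤ _ := mul_le_of_le_one_left (by positivity)
        (Real.rpow_le_one_of_one_le_of_nonpos hT (by linarith))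

lemma integral_mul_scaledKer {T : ℝ} (hT : 0 < T) (ψ : E → ℝ) (y : E) :
    ∫ x, ψ x * scaledKer a T (x - y) = ∫ z, ψ (y + T⁻¹ • z) * resKer a z := by
  rw [← integral_add_right_eq_self _ y]
  simp only [add_sub_cancel_right]
  have := Measure.integral_comp_smul (volume : Measure E)
    (fun z => ψ (y + T⁻¹ • z) * resKer a z) T
  rw [abs_of_pos (by positivity), smul_eq_mul, eq_inv_mul_iff_mul_eq₀ (by positivity),
    ← integral_const_mul] at this
  rw [← this]
  congr! 2 with z
  rw [inv_smul_smul₀ hT.ne', scaledKer, add_comm]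
  ring

end

/-! ### The approximate identity -/

section

variable [Nontrivial E] {a : ℝ} (h1 : (finrank ℝ E : ℝ) < a) (h2 : a < finrank ℝ E + 2)

include h1 h2

/-- The majorant, uniform in `T`, for the limit `T → ∞` against `u`. For small `y` use the
scale-invariant `L¹` norm of the kernel; for large `y` the support of `ψ` is far away and the
singular uniform bound applies. -/
lemma exists_integral_mul_scaledKer_le {ψ : E → ℝ} (hψ : Continuous ψ)
    (hψ0 : ∀ x, 1 ≤ ‖x‖ → ψ x = 0) : ∃ C, 0 ≤ C ∧ ∀ T : ℝ, 1 ≤ T → ∀ y : E,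
      |∫ x, ψ x * scaledKer a T (x - y)| ≤ C * (1 + ‖y‖) ^ (-a) := by
  have ha : 0 < a := lt_of_le_of_lt (by positivity) h1
  have hψc : HasCompactSupport ψ := HasCompactSupport.intro (isCompact_closedBall 0 1) fun x hx =>
    hψ0 x (by rw [mem_closedBall_zero_iff, not_le] at hx; exact hx.le)
  obtain ⟨M, hM⟩ := hψ.bounded_above_of_compact_support hψc
  have hM0 : 0 ≤ M := (norm_nonneg _).trans (hM 0)
  have hψi : Integrable ψ := hψ.integrable_of_hasCompactSupport hψc
  obtain ⟨C, hC0, hC⟩ := exists_scaledKer_le_norm_rpow (E := E) h1 h2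
  set I := ∫ z : E, ‖resKer a z‖
  have hI : 0 ≤ I := integral_nonneg fun _ => norm_nonneg _
  set F := ∫ y, ‖ψ y‖
  have hF : 0 ≤ F := integral_nonneg fun _ => norm_nonneg _
  refine ⟨3 ^ a * (M * I) + 4 ^ a * (C * F), by positivity, fun T hT y => ?_⟩
  have hT0 : 0 < T := by linarith
  have hy0 : 0 < 1 + ‖y‖ := by positivity
  rw [Real.rpow_neg hy0.le, ← div_eq_mul_inv, le_div_iff₀ (by positivity)]
  rcases le_total ‖y‖ 2 with hy | hy
  · have : |∫ x, ψ x * scaledKer a T (x - y)| ≤ M * I := by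
      rw [integral_mul_scaledKer h1 h2 hT0, ← integral_const_mul, ← Real.norm_eq_abs]
      refine norm_integral_le_of_norm_le ((integrable_resKer h1 h2).norm.const_mul M)
        (.of_forall fun z => ?_)
      rw [norm_mul]
      gcongr
      exact hM _
    calc |∫ x, ψ x * scaledKer a T (x - y)| * (1 + ‖y‖) ^ a ≤ (M * I) * 3 ^ a := by
          gcongr
          linarith
      _ ≤ _ := by rw [mul_comm]; exact le_add_of_nonneg_right (by positivity)
  · have hyp : 0 < ‖y‖ / 2 := by linarith
    have : |∫ x, ψ x * scaledKer a T (x - y)| ≤ C * (‖y‖ / 2) ^ (-a) * F := by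
      rw [← integral_const_mul, ← Real.norm_eq_abs]
      refine norm_integral_le_of_norm_le (hψi.norm.const_mul _) (.of_forall fun x => ?_)
      rw [norm_mul, mul_comm]
      rcases le_total 1 ‖x‖ with hx | hx
      · simp [hψ0 x hx]
      · have hxy : ‖y‖ / 2 ≤ ‖x - y‖ := by
          have := norm_sub_norm_le y x
          rw [norm_sub_rev] at this
          linarith
        gcongr
        exact (hC T hT _ (norm_pos_iff.1 (hyp.trans_le hxy))).trans (mul_le_mul_of_nonneg_left
          (Real.rpow_le_rpow_of_nonpos hyp hxy (by linarith)) hC0)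
    calc |∫ x, ψ x * scaledKer a T (x - y)| * (1 + ‖y‖) ^ a
        ≤ (C * (‖y‖ / 2) ^ (-a) * F) * (4 * (‖y‖ / 2)) ^ a := by
          gcongr
          linarith
      _ = 4 ^ a * (C * F) := by
          rw [Real.mul_rpow (by norm_num) hyp.le, Real.rpow_neg hyp.le]
          field_simp
      _ ≤ _ := le_add_of_nonneg_left (by positivity)

/-- The scaled reproducing kernels are an approximate identity. -/
lemma tendsto_integral_mul_scaledKer {u ψ : E → ℝ} (hu : AEStronglyMeasurable u volume)
    (hui : Integrable fun y => u y * (1 + ‖y‖) ^ (-a)) (hψ : Continuous ψ)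
    (hψ0 : ∀ x, 1 ≤ ‖x‖ → ψ x = 0) :
    Tendsto (fun T : ℝ => ∫ y, u y * ∫ x, ψ x * scaledKer a T (x - y)) atTop
      (𝓝 (∫ y, u y * (ψ y * ∫ z : E, resKer a z))) := by
  have hψc : HasCompactSupport ψ := HasCompactSupport.intro (isCompact_closedBall 0 1) fun x hx =>
    hψ0 x (by rw [mem_closedBall_zero_iff, not_le] at hx; exact hx.le)
  obtain ⟨M, hM⟩ := hψ.bounded_above_of_compact_support hψc
  obtain ⟨C, hC0, hC⟩ := exists_integral_mul_scaledKer_le h1 h2 hψ hψ0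
  have hK := integrable_resKer (E := E) h1 h2
  refine tendsto_integral_filter_of_dominated_convergence
    (fun y => C * ‖u y * (1 + ‖y‖) ^ (-a)‖) ?_ ?_ (hui.norm.const_mul C) (.of_forall fun y => ?_)
  · filter_upwards [eventually_ge_atTop 1] with T hT
    refine hu.mul (Continuous.aestronglyMeasurable ?_)
    simp only [integral_mul_scaledKer h1 h2 (zero_lt_one.trans_le hT)]
    refine continuous_of_dominated (bound := fun z => M * ‖resKer a z‖) (fun y => ?_)
      (fun y => .of_forall fun z => ?_) (hK.norm.const_mul M) (.of_forall fun z => ?_)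
    · exact (Continuous.aestronglyMeasurable (by fun_prop)).mul hK.aestronglyMeasurable
    · rw [norm_mul]
      gcongr
      exact hM _
    · exact (hψ.comp (by fun_prop)).mul continuous_const
  · filter_upwards [eventually_ge_atTop 1] with T hT
    refine .of_forall fun y => ?_
    rw [norm_mul, norm_mul, Real.norm_of_nonneg (r := (1 + ‖y‖) ^ (-a)) (by positivity)]
    have := mul_le_mul_of_nonneg_left (hC T hT y) (norm_nonneg (u y))
    rw [← Real.norm_eq_abs] at this
    linarith
  · refine Tendsto.const_mul _ ?_
    have : Tendsto (fun T : ℝ => ∫ z, ψ (y + T⁻¹ • z) * resKer a z) atTop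
        (𝓝 (∫ z : E, ψ y * resKer a z)) := by
      refine tendsto_integral_filter_of_dominated_convergence (fun z => M * ‖resKer a z‖)
        (.of_forall fun T => ?_) (.of_forall fun T => .of_forall fun z => ?_) (hK.norm.const_mul M)
        (.of_forall fun z => ?_)
      · exact (Continuous.aestronglyMeasurable (by fun_prop)).mul hK.aestronglyMeasurable
      · rw [norm_mul]
        gcongr
        exact hM _
      · refine Tendsto.mul_const _ ?_
        have h : Tendsto (fun T : ℝ => y + T⁻¹ • z) atTop (𝓝 (y + (0 : ℝ) • z)) :=
          (tendsto_inv_atTop_zero.smul_const z).const_add y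
        rw [zero_smul, add_zero] at h
        exact (hψ.tendsto y).comp h
    rw [integral_const_mul] at this
    refine this.congr' ?_
    filter_upwards [eventually_gt_atTop 0] with T hT
    exact (integral_mul_scaledKer h1 h2 hT ψ y).symm

end

/-! ### Convolution of a weighted integrable function with a decaying kernel -/

lemma integrable_smul_comp_sub {a : ℝ} (ha : 0 ≤ a) {u : E → ℝ}
    (hu : AEStronglyMeasurable u volume) (hui : Integrable fun y => u y * (1 + ‖y‖) ^ (-a))
    {k : E → G} (hk : Continuous k) {C : ℝ} (hC0 : 0 ≤ C)
    (hC : ∀ x, ‖k x‖ ≤ C * (1 + ‖x‖) ^ (-a)) (x : E) :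
    Integrable fun y => u y • k (x - y) := by
  refine (hui.norm.const_mul (C * (1 + ‖x‖) ^ a)).mono'
    (hu.smul (hk.comp (continuous_const.sub continuous_id)).aestronglyMeasurable)
    (.of_forall fun y => ?_)
  rw [norm_smul, norm_mul, Real.norm_of_nonneg (r := (1 + ‖y‖) ^ (-a)) (by positivity)]
  calc ‖u y‖ * ‖k (x - y)‖ ≤ ‖u y‖ * (C * ((1 + ‖x‖) ^ a * (1 + ‖y‖) ^ (-a))) := by
        gcongr
        refine (hC _).trans ?_
        gcongr
        exact one_add_norm_sub_rpow_neg_le ha x y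
    _ = _ := by ring

lemma norm_integral_smul_comp_sub_le {a : ℝ} (ha : 0 ≤ a) {u : E → ℝ}
    (hui : Integrable fun y => u y * (1 + ‖y‖) ^ (-a))
    {k : E → G} {C : ℝ} (hC0 : 0 ≤ C)
    (hC : ∀ x, ‖k x‖ ≤ C * (1 + ‖x‖) ^ (-a)) (x : E) :
    ‖∫ y, u y • k (x - y)‖ ≤ C * (1 + ‖x‖) ^ a * ∫ y, ‖u y * (1 + ‖y‖) ^ (-a)‖ := by
  rw [← integral_const_mul]
  refine norm_integral_le_of_norm_le (hui.norm.const_mul (C * (1 + ‖x‖) ^ a))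
    (.of_forall fun y => ?_)
  rw [norm_smul, norm_mul, Real.norm_of_nonneg (r := (1 + ‖y‖) ^ (-a)) (by positivity)]
  calc ‖u y‖ * ‖k (x - y)‖ ≤ ‖u y‖ * (C * ((1 + ‖x‖) ^ a * (1 + ‖y‖) ^ (-a))) := by
        gcongr
        refine (hC _).trans ?_
        gcongr
        exact one_add_norm_sub_rpow_neg_le ha x y
    _ = _ := by ring

lemma hasFDerivAt_integral_smul_comp_sub {a : ℝ} (ha : 0 ≤ a) {u : E → ℝ}
    (hu : AEStronglyMeasurable u volume) (hui : Integrable fun y => u y * (1 + ‖y‖) ^ (-a))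
    {k : E → G} {k' : E → E →L[ℝ] G} (hk : ∀ x, HasFDerivAt k (k' x) x) (hk' : Continuous k')
    {C : ℝ} (hC0 : 0 ≤ C) (hC : ∀ x, ‖k x‖ ≤ C * (1 + ‖x‖) ^ (-a))
    (hC' : ∀ x, ‖k' x‖ ≤ C * (1 + ‖x‖) ^ (-a)) (x₀ : E) :
    HasFDerivAt (fun x => ∫ y, u y • k (x - y)) (∫ y, u y • k' (x₀ - y)) x₀ := by
  have hkc : Continuous k := continuous_iff_continuousAt.2 fun x => (hk x).continuousAt
  refine hasFDerivAt_integral_of_dominated_of_fderiv_le (s := ball x₀ 1)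
    (bound := fun y => C * (2 + ‖x₀‖) ^ a * ‖u y * (1 + ‖y‖) ^ (-a)‖)
    (F' := fun x y => u y • k' (x - y)) (ball_mem_nhds _ one_pos)
    (.of_forall fun x => (integrable_smul_comp_sub ha hu hui hkc hC0 hC x).aestronglyMeasurable)
    (integrable_smul_comp_sub ha hu hui hkc hC0 hC x₀)
    (integrable_smul_comp_sub ha hu hui hk' hC0 hC' x₀).aestronglyMeasurable
    (.of_forall fun y x hx => ?_) (hui.norm.const_mul _) (.of_forall fun y x _ => ?_)
  · have hx' : 1 + ‖x‖ ≤ 2 + ‖x₀‖ := by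
      rw [mem_ball, dist_eq_norm] at hx
      have := norm_sub_norm_le x x₀
      linarith
    rw [norm_smul, norm_mul, Real.norm_of_nonneg (r := (1 + ‖y‖) ^ (-a)) (by positivity)]
    calc ‖u y‖ * ‖k' (x - y)‖ ≤ ‖u y‖ * (C * ((2 + ‖x₀‖) ^ a * (1 + ‖y‖) ^ (-a))) := by
          gcongr
          refine (hC' _).trans ?_
          gcongr
          refine (one_add_norm_sub_rpow_neg_le ha x y).trans ?_
          gcongr
      _ = _ := by ring
  · exact ((hasFDerivAt_comp_sub y).2 (hk (x - y))).const_smul (u y)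

lemma locallyIntegrable_of_integrable_mul_rpow {a : ℝ} (ha : 0 ≤ a) {u : E → ℝ}
    (hu : AEStronglyMeasurable u volume) (hui : Integrable fun y => u y * (1 + ‖y‖) ^ (-a)) :
    LocallyIntegrable u volume := by
  refine locallyIntegrable_iff.2 fun k hk => ?_
  obtain ⟨R, hR⟩ := hk.isBounded.exists_norm_le
  refine (hui.norm.const_mul ((1 + R) ^ a)).integrableOn.mono' hu.restrict ?_
  refine (ae_restrict_iff' hk.measurableSet).2 (.of_forall fun y hy => ?_)
  have hy0 : 0 < 1 + ‖y‖ := by positivity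
  have hR' := hR y hy
  rw [norm_mul, Real.norm_of_nonneg (r := (1 + ‖y‖) ^ (-a)) (by positivity)]
  calc ‖u y‖ = (1 + ‖y‖) ^ a * (‖u y‖ * (1 + ‖y‖) ^ (-a)) := by
        rw [Real.rpow_neg hy0.le]
        field_simp
    _ ≤ _ := by gcongr

/-! ### From bounded second derivatives to Sobolev spaces -/

section

variable {N : ℕ}

/-- The squared Lipschitz bound turns the integrand into a multiple of `kerMin` with exponent `N +
2θ`. The factor 4 appears because points of the unit ball are at distance at most 2. -/
lemma gagliardoSq_lt_top [Nontrivial (EuclideanSpace ℝ (Fin N))] {θ : ℝ} (hθ0 : 0 < θ) (hθ1 : θ < 1)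
    {A : Set (EuclideanSpace ℝ (Fin N))} (hA : MeasurableSet A) (hA1 : A ⊆ ball 0 1)
    {v : EuclideanSpace ℝ (Fin N) → ℝ} {M : ℝ}
    (hv : ∀ x ∈ A, ∀ y ∈ A, |v x - v y| ≤ M * ‖x - y‖) : gagliardoSq θ A v < ⊤ := by
  set a : ℝ := (N : ℝ) + 2 * θ
  have hk : Integrable (kerMin a : EuclideanSpace ℝ (Fin N) → ℝ) :=
    integrable_kerMin (by simp [a, hθ0]) (by simp [a]; linarith)
  set I := ∫⁻ z : EuclideanSpace ℝ (Fin N), ENNReal.ofReal (4 * M ^ 2 * kerMin a z)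
  have hI : I < ⊤ := by
    have := (hk.const_mul (4 * M ^ 2)).2
    rw [hasFiniteIntegral_iff_ofReal (.of_forall fun z =>
      mul_nonneg (by positivity) (kerMin_nonneg a z))] at this
    exact this
  have hin : ∀ x ∈ A, ∫⁻ y in A, ENNReal.ofReal (|v x - v y| ^ 2 / ‖x - y‖ ^ a) ≤ I := by
    intro x hx
    calc ∫⁻ y in A, ENNReal.ofReal (|v x - v y| ^ 2 / ‖x - y‖ ^ a)
        ≤ ∫⁻ y in A, ENNReal.ofReal (4 * M ^ 2 * kerMin a (x - y)) := by
          refine setLIntegral_mono' hA fun y hy => ENNReal.ofReal_le_ofReal ?_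
          have h2 : ‖x - y‖ ≤ 2 := by
            have hx1 := mem_ball_zero_iff.1 (hA1 hx)
            have hy1 := mem_ball_zero_iff.1 (hA1 hy)
            have := norm_sub_le x y
            linarith
          rw [kerMin, ← mul_assoc, div_eq_mul_inv]
          gcongr
          calc |v x - v y| ^ 2 ≤ (M * ‖x - y‖) ^ 2 := by
                gcongr
                exact hv x hx y hy
            _ = M ^ 2 * ‖x - y‖ ^ 2 := by ring
            _ ≤ M ^ 2 * (4 * min 1 (‖x - y‖ ^ 2)) := by
                gcongr
                rw [mul_min_of_nonneg _ _ (by norm_num)]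
                refine le_min ?_ ?_ <;> nlinarith [norm_nonneg (x - y)]
            _ = _ := by ring
      _ ≤ ∫⁻ y, ENNReal.ofReal (4 * M ^ 2 * kerMin a (x - y)) := setLIntegral_le_lintegral _ _
      _ = I := lintegral_sub_left_eq_self (fun z => ENNReal.ofReal (4 * M ^ 2 * kerMin a z)) x
  calc gagliardoSq θ A v ≤ ∫⁻ _ in A, I := setLIntegral_mono' hA hin
    _ = I * volume A := setLIntegral_const _ _
    _ < ⊤ := ENNReal.mul_lt_top hI ((measure_mono hA1).trans_lt measure_ball_lt_top)

/-- A function that agrees a.e. with a function with locally bounded second derivatives is in every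
Sobolev space of order less than two. -/
lemma memH_of_hasFDerivAt [Nontrivial (EuclideanSpace ℝ (Fin N))] {σ : ℝ} (hσ0 : 0 ≤ σ)
    (hσ2 : σ < 2) {A : Set (EuclideanSpace ℝ (Fin N))} (hA : IsOpen A) (hA1 : A ⊆ ball 0 1)
    {u F : EuclideanSpace ℝ (Fin N) → ℝ} {F' : EuclideanSpace ℝ (Fin N) → _ →L[ℝ] ℝ}
    {F'' : EuclideanSpace ℝ (Fin N) → _ →L[ℝ] _ →L[ℝ] ℝ}
    (hu : LocallyIntegrable u volume) (huF : ∀ᵐ x ∂volume, x ∈ A → u x = F x)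
    (hF : ∀ x, HasFDerivAt F (F' x) x) (hF' : ∀ x, HasFDerivAt F' (F'' x) x) {M : ℝ}
    (hM : ∀ x ∈ ball 0 1, ‖F'' x‖ ≤ M) : MemH σ A u := by
  have hFc : Continuous F := continuous_iff_continuousAt.2 fun x => (hF x).continuousAt
  have hFc' : Continuous F' := continuous_iff_continuousAt.2 fun x => (hF' x).continuousAt
  have hfin : IsFiniteMeasure (volume.restrict A) :=
    ⟨by simpa using (measure_mono hA1).trans_lt measure_ball_lt_top⟩
  have huF' : u =ᵐ[volume.restrict A] F := (ae_restrict_iff' hA.measurableSet).2 huF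
  have hmem : ∀ v : EuclideanSpace ℝ (Fin N) → ℝ, Continuous v →
      MemLp v 2 (volume.restrict A) := by
    intro v hv
    obtain ⟨C, hC⟩ := (isCompact_closedBall (0 : EuclideanSpace ℝ (Fin N)) 1).exists_bound_of_continuousOn
      hv.continuousOn
    exact MemLp.of_bound hv.aestronglyMeasurable C ((ae_restrict_iff' hA.measurableSet).2
      (.of_forall fun x hx => hC x (ball_subset_closedBall (hA1 hx))))
  have hgag : ∀ (v : EuclideanSpace ℝ (Fin N) → ℝ) (M : ℝ),
      (∀ x ∈ ball (0 : EuclideanSpace ℝ (Fin N)) 1, ∀ y ∈ ball (0 : EuclideanSpace ℝ (Fin N)) 1,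
        |v x - v y| ≤ M * ‖x - y‖) →
      0 < Int.fract σ → gagliardoSq (Int.fract σ) A v < ⊤ := fun v M hv h =>
    gagliardoSq_lt_top h (Int.fract_lt_one σ) hA.measurableSet hA1
      fun x hx y hy => hv x (hA1 hx) y (hA1 hy)
  have hint : ∀ f : EuclideanSpace ℝ (Fin N) → ℝ, (∀ x ∉ A, f x = 0) →
      ∫ x in A, f x = ∫ x, f x := fun f hf => setIntegral_eq_integral_of_forall_compl_eq_zero hf
  have hcongr : ∀ f : EuclideanSpace ℝ (Fin N) → ℝ,
      ∫ x in A, u x * f x = ∫ x in A, F x * f x := fun f =>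
    integral_congr_ae (huF'.mono fun x hx => by simp only [hx])
  refine ⟨(hmem F hFc).ae_eq huF'.symm, fun m hm ι => ?_⟩
  -- As `σ < 2`, only the function and its first derivatives enter. Both are Lipschitz on the unit
  -- ball.
  have hm1 : m ≤ 1 := Nat.lt_succ_iff.1 (hm.trans_lt ((Nat.floor_lt hσ0).2 (by exact_mod_cast hσ2)))
  interval_cases m
  · refine ⟨F, ⟨hu.locallyIntegrableOn _, hFc.locallyIntegrable.locallyIntegrableOn _,
      fun φ _ => ?_⟩, hmem F hFc, ?_⟩
    · simp only [iteratedFDeriv_zero_apply, pow_zero, one_mul]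
      exact hcongr φ
    · obtain ⟨C, hC⟩ := (isCompact_closedBall
        (0 : EuclideanSpace ℝ (Fin N)) 1).exists_bound_of_continuousOn hFc'.continuousOn
      refine hgag F C fun x hx y hy => ?_
      exact (convex_ball (0 : EuclideanSpace ℝ (Fin N)) 1).norm_image_sub_le_of_norm_hasFDerivWithin_le
        (fun z _ => (hF z).hasFDerivWithinAt) (fun z hz => hC z (ball_subset_closedBall hz)) hy hx
  · set e : EuclideanSpace ℝ (Fin N) := EuclideanSpace.single (ι 0) (1 : ℝ)
    have he : ‖e‖ = 1 := by simp [e]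
    have hvc : Continuous fun x => F' x e := hFc'.clm_apply continuous_const
    refine ⟨fun x => F' x e, ⟨hu.locallyIntegrableOn _, hvc.locallyIntegrable.locallyIntegrableOn _,
      fun φ hφ => ?_⟩, hmem _ hvc, hgag _ M fun x hx y hy => ?_⟩
    · obtain ⟨hφs, hφc, hφA⟩ := hφ
      have hdφ : Continuous fun x => fderiv ℝ φ x e :=
        (contDiff_infty_fderiv hφs).continuous.clm_apply continuous_const
      have hdφc : HasCompactSupport fun x => fderiv ℝ φ x e := hφc.fderiv_apply (𝕜 := ℝ) e
      have hφ0 : ∀ x ∉ A, φ x = 0 := fun x hx =>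
        image_eq_zero_of_notMem_tsupport fun h => hx (hφA h)
      have hdφ0 : ∀ x ∉ A, fderiv ℝ φ x e = 0 := fun x hx => by
        have : fderiv ℝ φ x = 0 := image_eq_zero_of_notMem_tsupport fun h =>
          hx (hφA (tsupport_fderiv_subset ℝ h))
        rw [this]; rfl
      simp only [iteratedFDeriv_one_apply, pow_one, neg_one_mul]
      have hfe : ∀ x, fderiv ℝ F x = F' x := fun x => (hF x).fderiv
      have key := integral_mul_fderiv_eq_neg_fderiv_mul_of_integrable (μ := volume) (f := F) (g := φ)
        (v := e) (by
          simp only [hfe]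
          exact (hvc.mul hφs.continuous).integrable_of_hasCompactSupport hφc.mul_left)
        ((hFc.mul hdφ).integrable_of_hasCompactSupport hdφc.mul_left)
        ((hFc.mul hφs.continuous).integrable_of_hasCompactSupport hφc.mul_left)
        (fun x _ => (hF x).differentiableAt)
        (fun x _ => hφs.differentiable (by simp) x)
      simp only [hfe] at key
      rw [hcongr, hint _ (fun x hx => by rw [hdφ0 x hx, mul_zero]),
        hint _ (fun x hx => by rw [hφ0 x hx, mul_zero])]
      exact key
    · have := (convex_ball (0 : EuclideanSpace ℝ (Fin N)) 1).norm_image_sub_le_of_norm_hasFDerivWithin_le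
        (fun z _ => (hF' z).hasFDerivWithinAt) hM hy hx
      rw [← Real.norm_eq_abs, ← sub_apply]
      have h := (F' x - F' y).le_opNorm e
      rw [he, mul_one] at h
      exact h.trans this

end

/-! ### Local reproduction by a single kernel -/

lemma norm_smul_le_abs_mul (c : ℝ) {v : G} {B : ℝ} (h : ‖v‖ ≤ B) : ‖c • v‖ ≤ |c| * B := by
  rw [norm_smul, Real.norm_eq_abs]
  gcongr

lemma exists_fderiv_scaledKer [Nontrivial E] {a : ℝ} (h1 : (finrank ℝ E : ℝ) < a)
    (h2 : a < finrank ℝ E + 2) {T : ℝ} (hT : 1 ≤ T) :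
    ∃ (K' : E → E →L[ℝ] ℝ) (K'' : E → E →L[ℝ] E →L[ℝ] ℝ) (C : ℝ),
      0 ≤ C ∧ (∀ x, HasFDerivAt (scaledKer a T) (K' x) x) ∧ (∀ x, HasFDerivAt K' (K'' x) x) ∧
      Continuous K'' ∧ (∀ x : E, ‖scaledKer a T x‖ ≤ C * (1 + ‖x‖) ^ (-a)) ∧
      (∀ x, ‖K' x‖ ≤ C * (1 + ‖x‖) ^ (-a)) ∧ (∀ x, ‖K'' x‖ ≤ C * (1 + ‖x‖) ^ (-a)) := by
  have ha : 0 < a := lt_of_le_of_lt (by positivity) h1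
  have hT0 : 0 < T := by linarith
  obtain ⟨K', K'', C, hC0, hK, hK', hc, b0, b1, b2⟩ := exists_fderiv_resKer (E := E) h1 h2
  have hw : ∀ x : E, (1 + ‖T • x‖) ^ (-a) ≤ (1 + ‖x‖) ^ (-a) := fun x => by
    refine Real.rpow_le_rpow_of_nonpos (by positivity) ?_ (by linarith)
    rw [norm_smul, Real.norm_of_nonneg hT0.le]
    nlinarith [norm_nonneg x]
  have hs : ∀ x : E, HasFDerivAt (fun x : E => T • x) (T • ContinuousLinearMap.id ℝ E) x :=
    fun x => (hasFDerivAt_id x).const_smul T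
  set D := T ^ finrank ℝ E * (T * (T * C))
  have hle : ∀ {c : ℝ}, 0 ≤ c → c ≤ T * c := fun hc => le_mul_of_one_le_left hc hT
  have hD1 : T ^ finrank ℝ E * (T * C) ≤ D := by
    refine mul_le_mul_of_nonneg_left (hle (by positivity)) (by positivity)
  have hD0 : T ^ finrank ℝ E * C ≤ D :=
    (mul_le_mul_of_nonneg_left (hle hC0) (by positivity)).trans hD1
  refine ⟨fun x => T ^ finrank ℝ E • T • K' (T • x), fun x => T ^ finrank ℝ E • T • T • K'' (T • x),
    D, by positivity, fun x => ?_, fun x => ?_, by fun_prop, fun x => ?_, fun x => ?_, fun x => ?_⟩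
  · have := ((hK (T • x)).comp x (hs x)).const_smul (T ^ finrank ℝ E)
    rw [ContinuousLinearMap.comp_smul, ContinuousLinearMap.comp_id] at this
    exact this
  · have := (((hK' (T • x)).comp x (hs x)).const_smul T).const_smul (T ^ finrank ℝ E)
    rw [ContinuousLinearMap.comp_smul, ContinuousLinearMap.comp_id] at this
    exact this
  · have hb := (b0 (T • x)).trans (mul_le_mul_of_nonneg_left (hw x) hC0)
    rw [scaledKer, norm_mul, norm_pow, Real.norm_of_nonneg hT0.le]
    calc _ ≤ T ^ finrank ℝ E * (C * (1 + ‖x‖) ^ (-a)) := by gcongr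
      _ = T ^ finrank ℝ E * C * (1 + ‖x‖) ^ (-a) := by ring
      _ ≤ _ := by gcongr
  · have hb := (b1 (T • x)).trans (mul_le_mul_of_nonneg_left (hw x) hC0)
    rw [norm_smul, norm_smul, norm_pow, Real.norm_of_nonneg hT0.le]
    calc _ ≤ T ^ finrank ℝ E * (T * (C * (1 + ‖x‖) ^ (-a))) := by gcongr
      _ = T ^ finrank ℝ E * (T * C) * (1 + ‖x‖) ^ (-a) := by ring
      _ ≤ _ := by gcongr
  · have hb := (b2 (T • x)).trans (mul_le_mul_of_nonneg_left (hw x) hC0)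
    have hb3 := norm_smul_le_abs_mul (T ^ finrank ℝ E)
      (norm_smul_le_abs_mul T
        (norm_smul_le_abs_mul (G := E →L[ℝ] E →L[ℝ] ℝ) T hb))
    rw [abs_of_pos hT0, abs_of_nonneg (by positivity)] at hb3
    calc _ ≤ T ^ finrank ℝ E * (T * (T * (C * (1 + ‖x‖) ^ (-a)))) := hb3
      _ = _ := by simp only [D]; ring

/-- If `u` has vanishing convolution with all differences of scaled kernels near the ball of radius
`r`, then it is reproduced there by its convolution with a single kernel. -/
lemma ae_eq_integral_smul_scaledKer [Nontrivial E] {a : ℝ} (h1 : (finrank ℝ E : ℝ) < a)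
    (h2 : a < finrank ℝ E + 2) {u : E → ℝ} (hu : AEStronglyMeasurable u volume)
    (hui : Integrable fun y => u y * (1 + ‖y‖) ^ (-a)) {r T₀ : ℝ} (hr1 : r ≤ 1) (hT₀ : 1 ≤ T₀)
    (hz : ∀ T, T₀ ≤ T → ∀ x ∈ ball (0 : E) r,
      ∫ y, u y * (scaledKer a T (x - y) - scaledKer a T₀ (x - y)) = 0) :
    ∀ᵐ x ∂volume, x ∈ ball (0 : E) r →
      u x = (∫ z : E, resKer a z)⁻¹ * ∫ y, u y • scaledKer a T₀ (x - y) := by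
  have ha : 0 < a := lt_of_le_of_lt (by positivity) h1
  have hcpos := integral_resKer_pos (E := E) h1 h2
  set c := ∫ z : E, resKer a z
  have hul := locallyIntegrable_of_integrable_mul_rpow ha.le hu hui
  obtain ⟨C, hC0, hC⟩ := exists_scaledKer_le (E := E) h1 h2
  have hC' : ∀ T : ℝ, 1 ≤ T → ∀ x : E,
      ‖scaledKer a T x‖ ≤ T ^ finrank ℝ E * C * (1 + ‖x‖) ^ (-a) := fun T hT x => hC T hT x
  have hpos : ∀ T : ℝ, 1 ≤ T → 0 ≤ T ^ finrank ℝ E * C := fun T hT => by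
    have : 0 ≤ T := by linarith
    positivity
  set F : ℝ → E → ℝ := fun T x => ∫ y, u y • scaledKer a T (x - y)
  have hint : ∀ T : ℝ, 1 ≤ T → ∀ x, Integrable fun y => u y • scaledKer a T (x - y) := fun T hT =>
    integrable_smul_comp_sub ha.le hu hui (continuous_scaledKer h1 h2 T) (hpos T hT) (hC' T hT)
  have hFeq : ∀ T, T₀ ≤ T → ∀ x ∈ ball (0 : E) r, F T x = F T₀ x := by
    intro T hT x hx
    have := hz T hT x hx
    simp only [mul_sub] at this
    exact sub_eq_zero.1 ((integral_sub (hint T (hT₀.trans hT) x) (hint T₀ hT₀ x)).symm.trans this)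
  have hFc : Continuous (F T₀) := by
    obtain ⟨K', K'', D, hD0, hK, hK', hc, b0, b1, b2⟩ := exists_fderiv_scaledKer (E := E) h1 h2 hT₀
    exact continuous_iff_continuousAt.2 fun x =>
      (hasFDerivAt_integral_smul_comp_sub ha.le hu hui hK
        (continuous_iff_continuousAt.2 fun x => (hK' x).continuousAt) hD0 b0 b1 x).continuousAt
  -- Tested against `g` supported in the small ball, the convolutions with `K_T` do not depend on `T
  -- ≥ T₀`, while they converge to `c ∫ g u`. Hence the constant value is the limit.
  have key : ∀ g : E → ℝ, ContDiff ℝ ∞ g → HasCompactSupport g → tsupport g ⊆ ball (0 : E) r →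
      ∫ x, g x • (u x - c⁻¹ * F T₀ x) = 0 := by
    intro g hg hgc hgr
    have hgr0 : ∀ x ∉ ball (0 : E) r, g x = 0 := fun x hx =>
      image_eq_zero_of_notMem_tsupport fun h => hx (hgr h)
    have hg0 : ∀ x, 1 ≤ ‖x‖ → g x = 0 := fun x hx => hgr0 x fun h =>
      absurd (mem_ball_zero_iff.1 h) (not_lt.2 (hr1.trans hx))
    have hlim := tendsto_integral_mul_scaledKer h1 h2 hu hui hg.continuous hg0
    have hconst : ∀ T, T₀ ≤ T →
        ∫ y, u y * ∫ x, g x * scaledKer a T (x - y) = ∫ x, g x * F T₀ x := by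
      intro T hT
      have hT1 := hT₀.trans hT
      have hFub : Integrable (fun p : E × E => g p.1 * (u p.2 * scaledKer a T (p.1 - p.2)))
          (volume.prod volume) := by
        have hgw : Integrable fun x => g x * (T ^ finrank ℝ E * C * (1 + ‖x‖) ^ a) := by
          refine Continuous.integrable_of_hasCompactSupport (hg.continuous.mul ?_) hgc.mul_right
          refine continuous_const.mul (Continuous.rpow_const (by fun_prop) fun x => Or.inr ha.le)
        refine (hgw.norm.mul_prod hui.norm).mono' ?_ (.of_forall fun p => ?_)
        · exact (hg.continuous.comp continuous_fst).aestronglyMeasurable.mul (hu.comp_snd.mul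
            ((continuous_scaledKer h1 h2 T).comp
              (continuous_fst.sub continuous_snd)).aestronglyMeasurable)
        · have hle := (hC' T hT1 (p.1 - p.2)).trans (mul_le_mul_of_nonneg_left
            (one_add_norm_sub_rpow_neg_le ha.le p.1 p.2) (hpos T hT1))
          have hp := hpos T hT1
          rw [norm_mul, norm_mul, norm_mul, norm_mul (u p.2),
            Real.norm_of_nonneg (r := (1 + ‖p.2‖) ^ (-a)) (by positivity),
            Real.norm_of_nonneg (r := _ * (1 + ‖p.1‖) ^ a) (by positivity)]
          calc _ ≤ ‖g p.1‖ * (‖u p.2‖ * (T ^ finrank ℝ E * C *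
                ((1 + ‖p.1‖) ^ a * (1 + ‖p.2‖) ^ (-a)))) := by gcongr
            _ = _ := by ring
      calc ∫ y, u y * ∫ x, g x * scaledKer a T (x - y)
          = ∫ y, ∫ x, g x * (u y * scaledKer a T (x - y)) := by
            congr! 2 with y
            rw [← integral_const_mul]
            congr! 2 with x
            ring
        _ = ∫ x, ∫ y, g x * (u y * scaledKer a T (x - y)) := (integral_integral_swap hFub).symm
        _ = ∫ x, g x * F T₀ x := by
            congr! 2 with x
            rw [integral_const_mul]
            by_cases hx : x ∈ ball (0 : E) r
            · rw [← hFeq T hT x hx]; rfl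
            · rw [hgr0 x hx, zero_mul, zero_mul]
    have heq : ∫ y, u y * (g y * c) = ∫ x, g x * F T₀ x := by
      refine tendsto_nhds_unique hlim (tendsto_const_nhds.congr' ?_)
      filter_upwards [eventually_ge_atTop T₀] with T hT
      exact (hconst T hT).symm
    have i1 : Integrable fun x => g x * u x :=
      hul.integrable_smul_left_of_hasCompactSupport hg.continuous hgc
    have i2 : Integrable fun x => g x * F T₀ x :=
      (hg.continuous.mul hFc).integrable_of_hasCompactSupport hgc.mul_right
    have e1 : ∫ y, u y * (g y * c) = c * ∫ x, g x * u x := by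
      rw [← integral_const_mul]
      congr! 2 with x
      ring
    have e2 : ∀ x, g x • (u x - c⁻¹ * F T₀ x) = g x * u x - c⁻¹ * (g x * F T₀ x) := fun x => by
      rw [smul_eq_mul]; ring
    simp only [e2]
    rw [integral_sub i1 (i2.const_mul _), integral_const_mul, ← heq, e1,
      inv_mul_cancel_left₀ hcpos.ne', sub_self]
  have := isOpen_ball.ae_eq_zero_of_integral_contDiff_smul_eq_zero
    ((hul.sub (hFc.const_mul c⁻¹).locallyIntegrable).locallyIntegrableOn _) key
  filter_upwards [this] with x hx hxr
  exact sub_eq_zero.1 (hx hxr)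

/-! ### Fractional Laplacian, weights and admissible test functions -/

section

variable {N : ℕ}

lemma fracLap_eq (s : ℝ) (ψ : EuclideanSpace ℝ (Fin N) → ℝ) (x : EuclideanSpace ℝ (Fin N)) :
    fracLap s ψ x = fracConst N s / 2 * hyperInt ((N : ℝ) + 2 * s) ψ x := by
  unfold fracLap hyperInt secondDiff
  congr! 3 with y
  rw [smul_eq_mul, smul_eq_mul, div_eq_inv_mul]

lemma fracConst_pos {s : ℝ} (hs0 : 0 < s) (hs1 : s < 1) : 0 < fracConst N s := by
  have h1 : 0 < Real.Gamma ((N : ℝ) / 2 + s) := Real.Gamma_pos_of_pos (by positivity)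
  have h2 : 0 < Real.Gamma (1 - s) := Real.Gamma_pos_of_pos (by linarith)
  have := Real.pi_pos
  unfold fracConst
  positivity

lemma weight_le {s : ℝ} (hs0 : 0 < s) (x : EuclideanSpace ℝ (Fin N)) :
    weight s x ≤ 2 * (1 + ‖x‖) ^ ((N : ℝ) + 2 * s) := by
  have e1 : (1 : ℝ) ≤ (1 + ‖x‖) ^ ((N : ℝ) + 2 * s) :=
    Real.one_le_rpow (by simp) (by positivity)
  have e2 : ‖x‖ ^ ((N : ℝ) + 2 * s) ≤ (1 + ‖x‖) ^ ((N : ℝ) + 2 * s) :=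
    Real.rpow_le_rpow (norm_nonneg x) (by simp) (by positivity)
  unfold weight
  linarith

lemma continuous_weight {s : ℝ} (hs0 : 0 < s) :
    Continuous (weight s : EuclideanSpace ℝ (Fin N) → ℝ) :=
  continuous_const.add (continuous_norm.rpow_const fun _ => Or.inr (by positivity))

lemma weight_pos (s : ℝ) (x : EuclideanSpace ℝ (Fin N)) : 0 < weight s x := by
  unfold weight; positivity

lemma MemL1s.integrable_mul_rpow {s : ℝ} (hs0 : 0 < s) {u : EuclideanSpace ℝ (Fin N) → ℝ}
    (hu : MemL1s s u) : Integrable fun y => u y * (1 + ‖y‖) ^ (-((N : ℝ) + 2 * s)) := by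
  refine (hu.2.norm.const_mul 2).mono' (hu.1.mul (Continuous.aestronglyMeasurable ?_))
    (.of_forall fun y => ?_)
  · exact Continuous.rpow_const (by fun_prop) fun y => Or.inl (by positivity)
  · have hw := weight_pos s y
    have hy : 0 < (1 + ‖y‖) ^ ((N : ℝ) + 2 * s) := by positivity
    rw [norm_mul, norm_div, Real.norm_of_nonneg hw.le, Real.rpow_neg (by positivity),
      Real.norm_of_nonneg (inv_nonneg.2 hy.le), ← div_eq_mul_inv, ← mul_div_assoc,
      div_le_div_iff₀ hy hw]
    nlinarith [weight_le hs0 y, norm_nonneg (u y)]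

lemma memL1s_of_continuous {s : ℝ} (hs0 : 0 < s) {φ : EuclideanSpace ℝ (Fin N) → ℝ}
    (hφ : Continuous φ) (hφc : HasCompactSupport φ) : MemL1s s φ :=
  ⟨hφ.aestronglyMeasurable, ((hφ.div (continuous_weight hs0)
    fun x => (weight_pos s x).ne').integrable_of_hasCompactSupport
      (hφc.mono fun x hx h => hx (by simp [h])))⟩

/-- Testing a very weak solution with truncated potentials. -/
lemma IsVeryWeakSolution.integral_mul_scaledKer_sub [Nontrivial (EuclideanSpace ℝ (Fin N))]
    {s : ℝ} (hs0 : 0 < s) (hs1 : s < 1) {g u : EuclideanSpace ℝ (Fin N) → ℝ}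
    (hu : IsVeryWeakSolution s (ball 0 1) g u) {T₀ T : ℝ} (hT₀ : 1 ≤ T₀) (hT : T₀ ≤ T)
    {x : EuclideanSpace ℝ (Fin N)} (hx : ‖x‖ + T₀⁻¹ < 1) :
    ∫ y, u y * (scaledKer ((N : ℝ) + 2 * s) T (x - y)
      - scaledKer ((N : ℝ) + 2 * s) T₀ (x - y)) = 0 := by
  set a : ℝ := (N : ℝ) + 2 * s
  have h1 : (finrank ℝ (EuclideanSpace ℝ (Fin N)) : ℝ) < a := by simp [a, hs0]
  have h2 : a < finrank ℝ (EuclideanSpace ℝ (Fin N)) + 2 := by simp [a]; linarith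
  have ha : 0 < a := lt_of_le_of_lt (by positivity) h1
  have hT₀0 : 0 < T₀ := by linarith
  set κ := fracConst N s / 2
  have hκ : 0 < κ := half_pos (fracConst_pos hs0 hs1)
  have hφ : Continuous fun y => truncPot a T₀ T (x - y) :=
    (continuous_truncPot a hT₀0).comp (continuous_const.sub continuous_id)
  have hts : tsupport (fun y => truncPot a T₀ T (x - y)) ⊆ closedBall x T₀⁻¹ := by
    refine closure_minimal (fun y hy => ?_) isClosed_closedBall
    by_contra h
    rw [mem_closedBall, dist_comm, dist_eq_norm, not_le] at h
    exact hy (truncPot_eq_zero hT₀0 h.le)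
  have hφc : HasCompactSupport fun y => truncPot a T₀ T (x - y) :=
    (isCompact_closedBall x T₀⁻¹).of_isClosed_subset (isClosed_tsupport _) hts
  have hcont : ∀ T, Continuous fun y => scaledKer a T (x - y) := fun T =>
    (continuous_scaledKer h1 h2 T).comp (continuous_const.sub continuous_id)
  obtain ⟨C, hC0, hC⟩ := exists_scaledKer_le (E := EuclideanSpace ℝ (Fin N)) h1 h2
  have hC' : ∀ T, 1 ≤ T → ∀ y, weight s y * |scaledKer a T (x - y)|
      ≤ 2 * (T ^ finrank ℝ (EuclideanSpace ℝ (Fin N)) * C * (1 + ‖x‖) ^ a) := by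
    intro T hT y
    have hT0 : 0 ≤ T := by linarith
    have hy : 0 < 1 + ‖y‖ := by positivity
    calc weight s y * |scaledKer a T (x - y)|
        ≤ (2 * (1 + ‖y‖) ^ a) * (T ^ finrank ℝ (EuclideanSpace ℝ (Fin N)) * C *
            ((1 + ‖x‖) ^ a * (1 + ‖y‖) ^ (-a))) := by
          gcongr
          · exact weight_le hs0 y
          · refine (hC T hT _).trans ?_
            gcongr
            exact one_add_norm_sub_rpow_neg_le ha.le x y
      _ = _ := by
          rw [Real.rpow_neg hy.le]
          field_simp
  -- The translated potential lives in the closed ball of radius `T₀⁻¹` about `x`, inside the unit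
  -- ball by `hx`; `κ` converts `hyperInt` into the normalised fractional Laplacian.
  have key := hu.integral_eq_zero (fun y => truncPot a T₀ T (x - y))
    (fun y => κ * (scaledKer a T (x - y) - scaledKer a T₀ (x - y)))
    (memL1s_of_continuous hs0 hφ hφc) hφc (hts.trans fun y hy => by
      rw [mem_closedBall, dist_eq_norm] at hy
      rw [mem_ball_zero_iff]
      have := norm_sub_norm_le y x
      linarith)
    (fun ψ hψ => by
      have := integral_truncPot_mul_hyperInt h1 h2 hT₀0 hT x hψ.1 hψ.2.1
      simp only [fracLap_eq, mul_left_comm _ (fracConst N s / 2), mul_assoc κ]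
      rw [integral_const_mul, integral_const_mul, this])
    ⟨(continuous_const.mul ((hcont T).sub (hcont T₀))).aestronglyMeasurable,
      κ * (2 * (T ^ finrank ℝ (EuclideanSpace ℝ (Fin N)) * C * (1 + ‖x‖) ^ a) +
        2 * (T₀ ^ finrank ℝ (EuclideanSpace ℝ (Fin N)) * C * (1 + ‖x‖) ^ a)),
      .of_forall fun y => by
        rw [abs_mul, abs_of_pos hκ, mul_left_comm]
        refine mul_le_mul_of_nonneg_left ?_ hκ.le
        have := mul_le_mul_of_nonneg_left
          (abs_sub (scaledKer a T (x - y)) (scaledKer a T₀ (x - y))) (weight_pos s y).le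
        rw [mul_add] at this
        linarith [hC' T (hT₀.trans hT) y, hC' T₀ hT₀ y]⟩
  simp only [mul_left_comm _ κ] at key
  rw [integral_const_mul] at key
  exact (mul_eq_zero.1 key).resolve_left hκ.ne'

end

end FracHarmonic

end

/-! ### The regularity theorem -/

theorem mainTheorem2 (N : ℕ) (hN : 2 ≤ N) (s : ℝ) (hs0 : 0 < s) (hs1 : s < 1)
    (g u : EuclideanSpace ℝ (Fin N) → ℝ)
    (hg : FracHarmonic.MemL1s s g)
    (hu : FracHarmonic.IsVeryWeakSolution s (Metric.ball 0 1) g u)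
    (hu2 : FracHarmonic.MemL2loc (Metric.ball 0 1) u) :
    FracHarmonic.MemHloc (2 * s) (Metric.ball 0 1) u := by
  open FracHarmonic in
  intro A hA hAc hA1
  have : Nontrivial (EuclideanSpace ℝ (Fin N)) :=
    Module.nontrivial_of_finrank_pos (R := ℝ) (by simp; omega)
  set a : ℝ := (N : ℝ) + 2 * s
  have h1 : (Module.finrank ℝ (EuclideanSpace ℝ (Fin N)) : ℝ) < a := by simp [a, hs0]
  have h2 : a < Module.finrank ℝ (EuclideanSpace ℝ (Fin N)) + 2 := by simp [a]; linarith
  have ha : 0 < a := lt_of_le_of_lt (by positivity) h1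
  obtain ⟨r, hr0, hr1, hr⟩ : ∃ r : ℝ, 0 ≤ r ∧ r < 1 ∧ A ⊆ ball 0 r := by
    obtain ⟨r, hr, hAr⟩ := exists_lt_subset_ball isClosed_closure hA1
    refine ⟨max r 0, le_max_right _ _, max_lt hr one_pos,
      (subset_closure.trans hAr).trans (ball_subset_ball (le_max_left _ _))⟩
  -- With this scale `|x| + T₀⁻¹ < 1` whenever `|x| < r`; taking `r ≥ 0` ensures `T₀ ≥ 1`.
  set T₀ := (1 - r)⁻¹
  have hT₀ : 1 ≤ T₀ := (one_le_inv₀ (by linarith)).2 (by linarith)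
  have hui := hu.memL1s.integrable_mul_rpow hs0
  have hrep := ae_eq_integral_smul_scaledKer h1 h2 hu.memL1s.1 hui hr1.le hT₀
    fun T hT x hx => hu.integral_mul_scaledKer_sub hs0 hs1 hT₀ hT (by
      have := mem_ball_zero_iff.1 hx
      simp only [T₀, inv_inv]
      linarith)
  obtain ⟨K', K'', C, hC0, hK, hK', hc, b0, b1, b2⟩ :=
    exists_fderiv_scaledKer (E := EuclideanSpace ℝ (Fin N)) h1 h2 hT₀
  set c := (∫ z : EuclideanSpace ℝ (Fin N), resKer a z)⁻¹
  refine memH_of_hasFDerivAt (by positivity) (by linarith) hA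
    (subset_closure.trans hA1)
    (locallyIntegrable_of_integrable_mul_rpow ha.le hu.memL1s.1 hui)
    (hrep.mono fun x hx hxA => hx (hr hxA))
    (F' := fun x => c • ∫ y, u y • K' (x - y)) (F'' := fun x => c • ∫ y, u y • K'' (x - y))
    (M := |c| * (C * 2 ^ a * ∫ y, ‖u y * (1 + ‖y‖) ^ (-a)‖))
    (fun x => ?_) (fun x => ?_) fun x hx => ?_
  · exact (hasFDerivAt_integral_smul_comp_sub ha.le hu.memL1s.1 hui hK
      (continuous_iff_continuousAt.2 fun x => (hK' x).continuousAt) hC0 b0 b1 x).const_smul c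
  · exact (hasFDerivAt_integral_smul_comp_sub ha.le hu.memL1s.1 hui hK' hc hC0 b1 b2 x).const_smul c
  · have hI : 0 ≤ ∫ y, ‖u y * (1 + ‖y‖) ^ (-a)‖ := integral_nonneg fun _ => norm_nonneg _
    have hx1 := mem_ball_zero_iff.1 hx
    -- On the unit ball `1 + |x| ≤ 2`, which accounts for the `2 ^ a` in the bound `M`.
    refine norm_smul_le_abs_mul c ((norm_integral_smul_comp_sub_le
      (G := EuclideanSpace ℝ (Fin N) →L[ℝ] EuclideanSpace ℝ (Fin N) →L[ℝ] ℝ)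
      ha.le hui hC0 b2 x).trans ?_)
    gcongr
    linarith
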